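/- **Notation.** Write points of $\mathbb C^2$ as $(z_1,z_2)$ with $z_j=x_j+iy_j$, and points of $\mathbb R\times\mathbb C$ as $(y_1,z_2)$. Let $\lambda_3$ denote three-dimensional measure (Lebesgue measure on $\mathbb R\times\mathbb C$, three-dimensional Hausdorff measure on subsets of $\mathbb C^2$). An open set $D\subset\mathbb C^2$ is pseudoconvex if $-\log\operatorname{dist}(\cdot,\mathbb C^2\setminus D)$ is plurisubharmonic on $D$; it is locally pseudoconvex at $\zeta\in\partial D$ if $B(\zeta,s)\cap D$ is pseudoconvex for some $s>0$. For a $C^1$ function $\varphi$ and a function $v\in W^{2,p}$ on an open subset of $\mathbb R\times\mathbb C$, put $$\tau(\varphi)=(\tau_1,\tau_2):=\Big(-\tfrac12\frac{\partial\varphi}{\partial z_2},\ \tfrac12\Big(1+i\frac{\partial\varphi}{\partial y_1}\Big)\Big),$$ $$\Delta_{\tau}v:=|\tau_1|^2\frac{\partial^2v}{\partial y_1^2}+2\Re\Big(i\tau_1\bar\tau_2\frac{\partial^2v}{\partial y_1\partial\bar z_2}\Big)+|\tau_2|^2\frac{\partial^2v}{\partial z_2\partial\bar z_2},$$ the second derivatives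 of $v$ being weak derivatives, so that $\Delta_\tau v$ is defined almost everywhere. **Proposition 3.1.** Let $\Omega\subset\mathbb C^2$ be a bounded domain and $F$ a closed subset of $\partial\Omega$ with $\lambda_3(F)=0$ such that, at every point of $\partial\Omega\setminus F$, the boundary is $C^2$-smooth and $\Omega$ is locally pseudoconvex. Let $r>0$, $U=B(0,r)\subset\mathbb C^2$, and let $U'\subset\mathbb R\times\mathbb C$ be an open set such that $(y_1,z_2)\in U'$ for all $(z_1,z_2)\in U$. Let $3<p\le\infty$, $\alpha\in(3/p,1)$, and let $\varphi:U'\to\mathbb R$ be a function in $W^{2,p}(U')$ which is $C^1$ with first derivatives $\alpha$-Hölder on every compact subset of $U'$, such that $\varphi(0,0)=0$, $\nabla\varphi(0,0)=0$ and $$\Omega\cap U=\{(z_1,z_2)\in U:\ x_1-\varphi(y_1,z_2)<0\}.$$ Let $F'=\{(y_1,z_2)\in U':(\varphi(y_1,z_2)+iy_1,z_2)\in F\cap U\}$, and suppose that $$\Delta_{\tau(\varphi)}\varphi\le0$$ at almost every $(y_1,z_2)\in U'\setminus F'$ with $(\varphi(y_1,z_2)+iy_1,z_2)\in U$. Then $\Omega\cap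 U$ is pseudoconvex. -/

import Mathlib

open MeasureTheory Set
open scoped ContDiff NNReal ENNReal ComplexConjugate

/-- `ℂ²` with its Euclidean norm; `z 0` and `z 1` are the coordinates `z₁` and `z₂`. -/
abbrev C2 : Type := EuclideanSpace ℂ (Fin 2)

/-! ### Plurisubharmonic functions and pseudoconvex open sets -/

/-- Plurisubharmonicity of a finite-valued function `u` on a set `D`: upper semicontinuity and
the sub-mean value inequality on every closed complex disc `{a + ζ w : |ζ| ≤ 1}` inside `D`.
Since `u a > -∞`, the sub-mean value inequality forces integrability of `u` on the boundary circle,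
so integrability is part of the condition. -/
def PlurisubharmonicOn (u : C2 → ℝ) (D : Set C2) : Prop :=
  UpperSemicontinuousOn u D ∧
    ∀ a w : C2, (∀ ζ : ℂ, ‖ζ‖ ≤ 1 → a + ζ • w ∈ D) →
      CircleIntegrable (fun ζ : ℂ => u (a + ζ • w)) 0 1 ∧
        u a ≤ Real.circleAverage (fun ζ : ℂ => u (a + ζ • w)) 0 1

/-- `D` is open and `-log δ_D` is plurisubharmonic on `D`, where `δ_D` is the Euclidean distance
to the complement of `D`.  (For `D = ℂ²` Lean's value of the function is the constant `0`.) -/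
def IsPseudoconvex (D : Set C2) : Prop :=
  IsOpen D ∧ PlurisubharmonicOn (fun z => -Real.log (Metric.infDist z Dᶜ)) D

/-- `D` is locally pseudoconvex at the boundary point `ζ`. -/
def IsLocallyPseudoconvexAt (D : Set C2) (ζ : C2) : Prop :=
  ∃ s : ℝ, 0 < s ∧ IsPseudoconvex (Metric.ball ζ s ∩ D)

/-- The boundary of `D` is `C²`-smooth at the boundary point `ζ`: near `ζ`, the set `D` is
`{ρ < 0}` for a `C²` function `ρ` with nonvanishing gradient and `ρ ζ = 0`. -/
def HasC2BoundaryAt (D : Set C2) (ζ : C2) : Prop :=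
  ∃ (V : Set C2) (ρ : C2 → ℝ), IsOpen V ∧ ζ ∈ V ∧ ρ ζ = 0 ∧ ContDiffOn ℝ 2 ρ V ∧
    (∀ z ∈ V, fderiv ℝ ρ z ≠ 0) ∧ D ∩ V = {z ∈ V | ρ z < 0}

/-! ### Function spaces on open subsets of `ℝ × ℂ` -/

/-- `φ ∈ C^{1,α}(V)`, `V` open: `φ` is `C¹` on `V` and its derivative is `α`-Hölder on every compact
subset of `V` (so in particular if it is `α`-Hölder on `V`). -/
def IsC1Holder (α : ℝ≥0) (φ : ℝ × ℂ → ℝ) (V : Set (ℝ × ℂ)) : Prop :=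
  ContDiffOn ℝ 1 φ V ∧
    ∀ K : Set (ℝ × ℂ), IsCompact K → K ⊆ V → ∃ C : ℝ≥0, HolderOnWith C α (fderiv ℝ φ) K

/-- The locally integrable function `g` is the weak (distributional) derivative of the locally
integrable function `f` on the open set `V` in the direction `e`. -/
def HasWeakDerivOn (V : Set (ℝ × ℂ)) (e : ℝ × ℂ) (f g : ℝ × ℂ → ℝ) : Prop :=
  LocallyIntegrableOn f V ∧ LocallyIntegrableOn g V ∧
    ∀ η : ℝ × ℂ → ℝ, ContDiff ℝ ∞ η → HasCompactSupport η → tsupport η ⊆ V →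
      ∫ ξ in V, f ξ * fderiv ℝ η ξ e = -∫ ξ in V, g ξ * η ξ

/-- `f ∈ W^{k,p}(V)`. -/
def MemSobolev (p : ℝ≥0∞) (V : Set (ℝ × ℂ)) : ℕ → (ℝ × ℂ → ℝ) → Prop
  | 0, f => MemLp f p (volume.restrict V)
  | k + 1, f => MemLp f p (volume.restrict V) ∧
      ∀ e : ℝ × ℂ, ∃ g : ℝ × ℂ → ℝ, HasWeakDerivOn V e f g ∧ MemSobolev p V k g

open Classical in
/-- A representative of the weak derivative of `f` on `V` in the direction `e` (unique up to a null
subset of `V`), and `0` if there is none. -/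
noncomputable def weakDeriv (V : Set (ℝ × ℂ)) (e : ℝ × ℂ) (f : ℝ × ℂ → ℝ) : ℝ × ℂ → ℝ :=
  if h : ∃ g, HasWeakDerivOn V e f g then h.choose else 0

/-! ### The operator `Δ_τ`

Points of `ℝ × ℂ` are written `(y₁, z₂)`, with `z₂ = x₂ + i y₂`. -/

/-- The direction of `∂/∂y₁`. -/
def dirY1 : ℝ × ℂ := (1, 0)

/-- The direction of `∂/∂x₂`. -/
def dirX2 : ℝ × ℂ := (0, 1)

/-- The direction of `∂/∂y₂`. -/
def dirY2 : ℝ × ℂ := (0, Complex.I)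

/-- `∂²v/∂y₁²`, in the weak sense. -/
noncomputable def dY1Y1 (V : Set (ℝ × ℂ)) (v : ℝ × ℂ → ℝ) (ξ : ℝ × ℂ) : ℝ :=
  weakDeriv V dirY1 (weakDeriv V dirY1 v) ξ

/-- `∂²v/∂y₁∂z̄₂`, in the weak sense, where `∂/∂z̄₂ = (∂/∂x₂ + i ∂/∂y₂) / 2`. -/
noncomputable def dY1Zbar2 (V : Set (ℝ × ℂ)) (v : ℝ × ℂ → ℝ) (ξ : ℝ × ℂ) : ℂ :=
  ((weakDeriv V dirY1 (weakDeriv V dirX2 v) ξ : ℂ) +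
    Complex.I * (weakDeriv V dirY1 (weakDeriv V dirY2 v) ξ : ℂ)) / 2

/-- `∂²v/∂z₂∂z̄₂ = (∂²v/∂x₂² + ∂²v/∂y₂²) / 4`, in the weak sense. -/
noncomputable def dZ2Zbar2 (V : Set (ℝ × ℂ)) (v : ℝ × ℂ → ℝ) (ξ : ℝ × ℂ) : ℝ :=
  (weakDeriv V dirX2 (weakDeriv V dirX2 v) ξ + weakDeriv V dirY2 (weakDeriv V dirY2 v) ξ) / 4

/-- `Δ_τ v = |τ₁|² ∂²v/∂y₁² + 2 Re (i τ₁ τ̄₂ ∂²v/∂y₁∂z̄₂) + |τ₂|² ∂²v/∂z₂∂z̄₂`. -/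
noncomputable def deltaOp (V : Set (ℝ × ℂ)) (τ : ℝ × ℂ → ℂ × ℂ) (v : ℝ × ℂ → ℝ)
    (ξ : ℝ × ℂ) : ℝ :=
  ‖(τ ξ).1‖ ^ 2 * dY1Y1 V v ξ
    + 2 * (Complex.I * (τ ξ).1 * conj (τ ξ).2 * dY1Zbar2 V v ξ).re
    + ‖(τ ξ).2‖ ^ 2 * dZ2Zbar2 V v ξ

/-- `τ(φ) = (-½ ∂φ/∂z₂, ½ (1 + i ∂φ/∂y₁))` for a `C¹` function `φ`, where
`∂/∂z₂ = (∂/∂x₂ - i ∂/∂y₂) / 2`. -/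
noncomputable def tauOf (φ : ℝ × ℂ → ℝ) (ξ : ℝ × ℂ) : ℂ × ℂ :=
  (-(1 / 2) * (((fderiv ℝ φ ξ dirX2 : ℂ) - Complex.I * (fderiv ℝ φ ξ dirY2 : ℂ)) / 2),
    (1 / 2) * (1 + Complex.I * (fderiv ℝ φ ξ dirY1 : ℂ)))

/-- The point `(φ(y₁, z₂) + i y₁, z₂)` of the graph of `φ`, for `ξ = (y₁, z₂)`. -/
noncomputable def graphPoint (φ : ℝ × ℂ → ℝ) (ξ : ℝ × ℂ) : C2 :=
  !₂[(φ ξ : ℂ) + Complex.I * (ξ.1 : ℂ), ξ.2]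

/-- The set `F'` of the parameters in `V` whose graph point lies in `F ∩ U`. -/
def graphParams (φ : ℝ × ℂ → ℝ) (V : Set (ℝ × ℂ)) (F U : Set C2) : Set (ℝ × ℂ) :=
  {ξ ∈ V | graphPoint φ ξ ∈ F ∩ U}

open Filter Topology

/-! ### Weak derivatives -/

/-! Write D for the intersection of Ω and U, and δ for the distance to its complement. The proof has
a geometric half, which reduces pseudoconvexity to the absence of certain touching discs, and an
analytic half, which excludes them.

Geometry. Suppose -log δ violates the sub-mean value inequality on an affine disc. Approximate its
boundary values from above by the real part of an entire function, locate an interior maximum z₀ of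
the difference plus a small multiple of |ζ|², and push the disc holomorphically towards a nearest
point b of the complement. This gives an entire disc q with q(z₀) = b outside D and δ(q(ζ)) ≥ c|ζ -
z₀|² near z₀ (`exists_touching_disc`). By the maximum principle for |q| the point b lies in the open
ball U (`norm_lt_of_touching_disc`), hence on the graph of φ, and near z₀ the disc lies below the
graph with a vertical gap of at least c|ζ - z₀|² (`graph_gap_of_infDist`).

Analysis. If φ were C², the Laplacian at z₀ would make the Levi form of φ at least 4c on the complex
tangent q'(z₀), whereas Δ_τ φ ≤ 0 makes it nonpositive on complex tangents. Here second derivatives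
exist only almost everywhere, so φ is replaced by a mollification at scale ε
(`not_disc_touches_graph`). The error is O(ε^(1+α)), so the perturbed maximum moves by O(ε^α); there
q' is complex tangent to the graph up to O(ε^α) at every parameter within ε, and the mollified Levi
form is still at least 2c. That form is an average of the almost everywhere Levi forms of φ. The
tangential part is nonpositive, and the deviation from tangency costs O(ε^α) times the average of
|D²φ|, which is O(ε^(-3/p)) by Hölder's inequality. Since α > 3/p the total error tends to 0, a
contradiction.

The set F' does not matter: it lies in the image of the null set F under the 1-Lipschitz projection
to the parameters (`volume_graphParams_eq_zero`). -/

theorem integrable_mul_of_tsupport_subset {V : Set (ℝ × ℂ)} {k η : ℝ × ℂ → ℝ}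
    (hk : LocallyIntegrableOn k V) (hη : Continuous η) (hc : HasCompactSupport η)
    (hs : tsupport η ⊆ V) : Integrable (fun ξ => k ξ * η ξ) := by
  have hK : IntegrableOn k (tsupport η) := hk.integrableOn_compact_subset hs hc
  have h := hK.continuousOn_smul hη.continuousOn hc
  have : Integrable (fun ξ => η ξ • k ξ) :=
    (integrableOn_iff_integrable_of_support_subset (fun x hx => subset_tsupport _ (by
      intro h0; apply hx; simp [h0]))).1 h
  simpa [mul_comm] using this

theorem HasWeakDerivOn.ae_eq {V : Set (ℝ × ℂ)} (hV : IsOpen V) {e : ℝ × ℂ} {f g g' : ℝ × ℂ → ℝ}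
    (h : HasWeakDerivOn V e f g) (h' : HasWeakDerivOn V e f g') :
    g =ᵐ[volume.restrict V] g' := by
  rw [Filter.EventuallyEq, ae_restrict_iff' hV.measurableSet]
  have key : ∀ᵐ x : ℝ × ℂ, x ∈ V → (g - g') x = 0 := by
    refine hV.ae_eq_zero_of_integral_contDiff_smul_eq_zero (h.2.1.sub h'.2.1) ?_
    intro η hη hc hs
    have e1 := h.2.2 η hη hc hs
    have e2 := h'.2.2 η hη hc hs
    have hint : ∀ {k : ℝ × ℂ → ℝ}, LocallyIntegrableOn k V →
        IntegrableOn (fun ξ => k ξ * η ξ) V := fun hk =>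
      (integrable_mul_of_tsupport_subset hk hη.continuous hc hs).integrableOn
    have e3 : ∫ ξ in V, (g ξ * η ξ - g' ξ * η ξ) = 0 := by
      rw [integral_sub (hint h.2.1) (hint h'.2.1)]
      linarith
    rw [← setIntegral_eq_integral_of_forall_compl_eq_zero (s := V), ← e3]
    · refine integral_congr_ae (Eventually.of_forall fun x => ?_)
      simp only [Pi.sub_apply, smul_eq_mul]; ring
    · intro x hx
      have : η x = 0 := by
        by_contra h0
        exact hx (hs (subset_tsupport _ h0))
      simp [this]
  filter_upwards [key] with x hx hxV
  have := hx hxV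
  simpa [sub_eq_zero] using this

theorem HasWeakDerivOn.congr_left {V : Set (ℝ × ℂ)} {e : ℝ × ℂ}
    {f f' g : ℝ × ℂ → ℝ} (h : HasWeakDerivOn V e f g) (hf' : LocallyIntegrableOn f' V)
    (hff' : f =ᵐ[volume.restrict V] f') : HasWeakDerivOn V e f' g := by
  refine ⟨hf', h.2.1, fun η hη hc hs => ?_⟩
  rw [← h.2.2 η hη hc hs]
  refine integral_congr_ae ?_
  filter_upwards [hff'] with x hx
  rw [hx]

theorem hasWeakDerivOn_weakDeriv {V : Set (ℝ × ℂ)} {e : ℝ × ℂ} {f g : ℝ × ℂ → ℝ}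
    (h : HasWeakDerivOn V e f g) : HasWeakDerivOn V e f (weakDeriv V e f) := by
  have hex : ∃ g, HasWeakDerivOn V e f g := ⟨g, h⟩
  rw [weakDeriv, dif_pos hex]
  exact hex.choose_spec

theorem MemSobolev.hasWeakDerivOn {p : ℝ≥0∞} {V : Set (ℝ × ℂ)} {k : ℕ} {f : ℝ × ℂ → ℝ}
    (h : MemSobolev p V (k + 1) f) (e : ℝ × ℂ) : HasWeakDerivOn V e f (weakDeriv V e f) := by
  obtain ⟨g, hg, -⟩ := h.2 e
  exact hasWeakDerivOn_weakDeriv hg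

/-- The Sobolev condition supplies second derivatives of some first weak derivative, not of the
chosen representative `weakDeriv`. Almost everywhere uniqueness transfers them to that
representative. -/
theorem MemSobolev.hasWeakDerivOn_weakDeriv {p : ℝ≥0∞} {V : Set (ℝ × ℂ)} (hV : IsOpen V)
    {f : ℝ × ℂ → ℝ} (h : MemSobolev p V 2 f) (e e' : ℝ × ℂ) :
    HasWeakDerivOn V e' (weakDeriv V e f) (weakDeriv V e' (weakDeriv V e f)) ∧
      MemLp (weakDeriv V e' (weakDeriv V e f)) p (volume.restrict V) := by
  obtain ⟨g, hg, -, hg2⟩ := h.2 e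
  obtain ⟨k, hk, hkp⟩ := hg2 e'
  have h1 := h.hasWeakDerivOn e
  have h2 := hk.congr_left h1.2.1 (hg.ae_eq hV h1)
  have h3 := _root_.hasWeakDerivOn_weakDeriv h2
  exact ⟨h3, (memLp_congr_ae (h2.ae_eq hV h3)).1 hkp⟩

/-! ### Mollification on `ℝ × ℂ` -/

instance isAddHaarMeasure_volume_real_prod_complex :
    (volume : Measure (ℝ × ℂ)).IsAddHaarMeasure :=
  inferInstanceAs ((volume : Measure ℝ).prod (volume : Measure ℂ)).IsAddHaarMeasure

/-- The convolution of `f` and `g`. -/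
noncomputable def mollify (f g : ℝ × ℂ → ℝ) (x : ℝ × ℂ) : ℝ := ∫ t, f t * g (x - t)

theorem mollify_eq_convolution (f g : ℝ × ℂ → ℝ) :
    mollify f g = convolution f g (ContinuousLinearMap.mul ℝ ℝ) volume := by
  ext x
  simp [mollify, convolution_def]

theorem mollify_comm (f g : ℝ × ℂ → ℝ) : mollify f g = mollify g f := by
  ext x
  rw [mollify, ← integral_sub_left_eq_self _ _ x]
  simp [mollify, mul_comm]

theorem contDiff_mollify {f g : ℝ × ℂ → ℝ} (hf : LocallyIntegrable f) (hg : ContDiff ℝ ∞ g)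
    (hc : HasCompactSupport g) : ContDiff ℝ ∞ (mollify f g) := by
  rw [mollify_eq_convolution]
  exact hc.contDiff_convolution_right (n := ⊤) _ hf hg

theorem fderiv_mollify_right {f g : ℝ × ℂ → ℝ} (hf : LocallyIntegrable f) (hg : ContDiff ℝ 1 g)
    (hc : HasCompactSupport g) (x e : ℝ × ℂ) :
    fderiv ℝ (mollify f g) x e = mollify f (fun y => fderiv ℝ g y e) x := by
  rw [mollify_eq_convolution, mollify_eq_convolution,
    (hc.hasFDerivAt_convolution_right _ hf hg x).fderiv]
  exact convolution_precompR_apply _ hf (hc.fderiv ℝ) (hg.continuous_fderiv one_ne_zero) _ _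

theorem fderiv_fderiv_mollify {f g : ℝ × ℂ → ℝ} (hf : LocallyIntegrable f) (hg : ContDiff ℝ ∞ g)
    (hc : HasCompactSupport g) (x e e' : ℝ × ℂ) :
    fderiv ℝ (fderiv ℝ (mollify f g)) x e' e =
      mollify f (fun y => fderiv ℝ (fun z => fderiv ℝ g z e) y e') x := by
  have hd : Differentiable ℝ (fderiv ℝ (mollify f g)) :=
    ((contDiff_mollify hf hg hc).fderiv_right (m := ∞) (by norm_num)).differentiable (by simp)
  have hge : ContDiff ℝ 1 (fun y => fderiv ℝ g y e) :=
    ((hg.fderiv_right (m := ∞) (by norm_num)).clm_apply contDiff_const).of_le (by norm_num)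
  have h1 : fderiv ℝ (fderiv ℝ (mollify f g)) x e' e =
      fderiv ℝ (fun y => fderiv ℝ (mollify f g) y e) x e' := by
    rw [((hd x).hasFDerivAt.clm_apply (hasFDerivAt_const e x)).fderiv]
    simp
  rw [h1]
  have h2 : (fun y => fderiv ℝ (mollify f g) y e) = mollify f (fun y => fderiv ℝ g y e) := by
    ext y
    exact fderiv_mollify_right hf (hg.of_le (by norm_num)) hc y e
  rw [h2, fderiv_mollify_right hf hge (hc.fderiv_apply ℝ e)]

theorem fderiv_comp_sub_left_apply {g : ℝ × ℂ → ℝ} (hg : Differentiable ℝ g) (x t e : ℝ × ℂ) :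
    fderiv ℝ (fun t => g (x - t)) t e = -fderiv ℝ g (x - t) e := by
  have := ((hg (x - t)).hasFDerivAt.comp t ((hasFDerivAt_id t).const_sub x)).fderiv
  change fderiv ℝ (g ∘ HSub.hSub x) t e = _
  rw [this]; simp

/-- Both derivatives fall on the mollifier, and two integrations by parts against t ↦ g(x - t)
return them to φ as weak derivatives. That test function is supported in the ball about x, so only
the values of f there matter; f is a global stand-in for φ. -/
theorem fderiv_fderiv_mollify_eq_integral {V : Set (ℝ × ℂ)} {φ f g h k : ℝ × ℂ → ℝ}
    {x e e' : ℝ × ℂ} {ε : ℝ}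
    (hf : LocallyIntegrable f) (hg : ContDiff ℝ ∞ g) (hc : HasCompactSupport g)
    (hs : tsupport g ⊆ Metric.closedBall 0 ε) (hx : Metric.closedBall x ε ⊆ V)
    (hfφ : ∀ t ∈ Metric.closedBall x ε, f t = φ t)
    (hh : HasWeakDerivOn V e' φ h) (hk : HasWeakDerivOn V e h k) :
    fderiv ℝ (fderiv ℝ (mollify f g)) x e' e = ∫ t in V, k t * g (x - t) := by
  have hge : ∀ v, ContDiff ℝ ∞ (fun y => fderiv ℝ g y v) := fun v =>
    (hg.fderiv_right (m := ∞) (by norm_num)).clm_apply contDiff_const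
  set θ : ℝ × ℂ → ℝ := fun t => g (x - t) with hθ
  have hθs : ContDiff ℝ ∞ θ := hg.comp (contDiff_const.sub contDiff_id)
  have hθeq : θ = g ∘ Homeomorph.subLeft x := rfl
  have hθc : HasCompactSupport θ := hc.comp_homeomorph (Homeomorph.subLeft x)
  have hθt : tsupport θ ⊆ Metric.closedBall x ε := by
    rw [hθeq, tsupport_comp_eq_preimage]
    intro t ht
    have := hs ht
    simpa [dist_eq_norm, norm_sub_rev] using this
  have hd1 : ∀ v, (fun t => fderiv ℝ θ t v) = fun t => -fderiv ℝ g (x - t) v := by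
    intro v; ext t
    exact fderiv_comp_sub_left_apply (hg.differentiable (by simp)) x t v
  have hd2 : ∀ t, fderiv ℝ (fun z => fderiv ℝ θ z e) t e' =
      fderiv ℝ (fun z => fderiv ℝ g z e) (x - t) e' := by
    intro t
    rw [hd1]
    have := fderiv_comp_sub_left_apply (g := fun z => fderiv ℝ g z e)
      ((hge e).differentiable (by simp)) x t e'
    rw [fderiv_fun_neg, neg_apply, this, neg_neg]
  have hθ1 : ContDiff ℝ ∞ (fun t => fderiv ℝ θ t e) :=
    (hθs.fderiv_right (m := ∞) (by norm_num)).clm_apply contDiff_const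
  have hθ1c : HasCompactSupport (fun t => fderiv ℝ θ t e) := hθc.fderiv_apply ℝ e
  have hθ1t : tsupport (fun t => fderiv ℝ θ t e) ⊆ Metric.closedBall x ε :=
    (tsupport_fderiv_apply_subset ℝ e).trans hθt
  have hθ2t : tsupport (fun t => fderiv ℝ (fun z => fderiv ℝ θ z e) t e') ⊆
      Metric.closedBall x ε := (tsupport_fderiv_apply_subset ℝ e').trans hθ1t
  have e1 := hh.2.2 _ hθ1 hθ1c (hθ1t.trans hx)
  have e2 := hk.2.2 _ hθs hθc (hθt.trans hx)
  rw [fderiv_fderiv_mollify hf hg hc, mollify]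
  calc ∫ t, f t * fderiv ℝ (fun z => fderiv ℝ g z e) (x - t) e'
      = ∫ t, φ t * fderiv ℝ (fun z => fderiv ℝ θ z e) t e' := by
        refine integral_congr_ae (Eventually.of_forall fun t => ?_)
        simp only
        by_cases ht : t ∈ Metric.closedBall x ε
        · rw [hfφ t ht, hd2]
        · have : fderiv ℝ (fun z => fderiv ℝ θ z e) t e' = 0 := by
            by_contra h0
            exact ht (hθ2t (subset_tsupport _ h0))
          rw [← hd2, this, mul_zero, mul_zero]
    _ = ∫ t in V, φ t * fderiv ℝ (fun z => fderiv ℝ θ z e) t e' := by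
        symm
        refine setIntegral_eq_integral_of_forall_compl_eq_zero fun t ht => ?_
        have : fderiv ℝ (fun z => fderiv ℝ θ z e) t e' = 0 := by
          by_contra h0
          exact ht (hx (hθ2t (subset_tsupport _ h0)))
        rw [this, mul_zero]
    _ = ∫ t in V, k t * g (x - t) := by rw [e1, e2, neg_neg]

theorem integrable_translate_mul {V : Set (ℝ × ℂ)} {k g : ℝ × ℂ → ℝ} {x : ℝ × ℂ} {ε : ℝ}
    (hk : LocallyIntegrableOn k V) (hg : Continuous g) (hc : HasCompactSupport g)
    (hs : tsupport g ⊆ Metric.closedBall 0 ε) (hx : Metric.closedBall x ε ⊆ V) :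
    Integrable (fun t => k t * g (x - t)) := by
  refine integrable_mul_of_tsupport_subset hk (hg.comp (continuous_const.sub continuous_id))
    (hc.comp_homeomorph (Homeomorph.subLeft x)) ?_
  change tsupport (g ∘ Homeomorph.subLeft x) ⊆ V
  rw [tsupport_comp_eq_preimage]
  intro t ht
  apply hx
  have := hs ht
  simpa [dist_eq_norm, norm_sub_rev] using this

/-- A symmetric mollifier of radius `ε` whose supremum is at most `C / ε ^ 3`. -/
structure IsMollifier (C ε : ℝ) (θ : ℝ × ℂ → ℝ) : Prop where
  contDiff : ContDiff ℝ ∞ θ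
  hasCompactSupport : HasCompactSupport θ
  tsupport_subset : tsupport θ ⊆ Metric.closedBall 0 ε
  nonneg : ∀ x, 0 ≤ θ x
  neg : ∀ x, θ (-x) = θ x
  integral_eq_one : ∫ x, θ x = 1
  le : ∀ x, θ x ≤ C / ε ^ 3

theorem exists_isMollifier : ∃ C : ℝ, 0 < C ∧ ∀ ε : ℝ, 0 < ε → ∃ θ, IsMollifier C ε θ := by
  have hv : 0 < volume.real (Metric.ball (0 : ℝ × ℂ) 1) :=
    ENNReal.toReal_pos (Metric.measure_ball_pos _ _ one_pos).ne' measure_ball_lt_top.ne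
  -- The bump equals 1 on the ball of radius ε/2, whose volume is (ε/2)³ times that of the unit
  -- ball; this produces the factor 8.
  refine ⟨8 / volume.real (Metric.ball (0 : ℝ × ℂ) 1), by positivity, fun ε hε => ?_⟩
  let η : ContDiffBump (0 : ℝ × ℂ) := ⟨ε / 2, ε, by positivity, by linarith⟩
  refine ⟨η.normed volume, η.contDiff_normed (n := ⊤), η.hasCompactSupport_normed, ?_,
    fun x => η.nonneg_normed x, fun x => η.normed_neg x, η.integral_normed, fun x => ?_⟩
  · rw [η.tsupport_normed_eq]
  · refine (η.normed_le_div_measure_closedBall_rIn volume x).trans (le_of_eq ?_)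
    have : volume.real (Metric.closedBall (0 : ℝ × ℂ) η.rIn) =
        (ε / 2) ^ 3 * volume.real (Metric.ball (0 : ℝ × ℂ) 1) := by
      rw [measureReal_def, Measure.addHaar_closedBall _ _ (by positivity : (0 : ℝ) ≤ ε / 2)]
      have h3 : Module.finrank ℝ (ℝ × ℂ) = 3 := by simp
      rw [ENNReal.toReal_mul, h3, ENNReal.toReal_ofReal (by positivity), measureReal_def]
    rw [this]
    field_simp
    norm_num

theorem IsMollifier.eq_zero {C ε : ℝ} {θ : ℝ × ℂ → ℝ} (h : IsMollifier C ε θ) {x : ℝ × ℂ}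
    (hx : ε < ‖x‖) : θ x = 0 := by
  by_contra h0
  have := h.tsupport_subset (subset_tsupport _ h0)
  simp at this
  linarith

theorem IsMollifier.integrable {C ε : ℝ} {θ : ℝ × ℂ → ℝ} (h : IsMollifier C ε θ) :
    Integrable θ := h.contDiff.continuous.integrable_of_hasCompactSupport h.hasCompactSupport

theorem IsMollifier.abs_mollify_sub_le {C ε M : ℝ} {θ k : ℝ × ℂ → ℝ} (h : IsMollifier C ε θ)
    (hk : Continuous k) {x : ℝ × ℂ} (hM : ∀ y ∈ Metric.closedBall x ε, |k y - k x| ≤ M) :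
    |mollify k θ x - k x| ≤ M := by
  have h1 : mollify k θ x - k x = ∫ t, (k (x - t) - k x) * θ t := by
    rw [mollify_comm, mollify]
    have : k x = ∫ t, k x * θ t := by rw [integral_const_mul, h.integral_eq_one, mul_one]
    rw [this]
    rw [← integral_sub]
    · congr 1; ext t; ring_nf
      simp only [integral_const_mul, h.integral_eq_one]
      ring
    · have : Continuous fun t => θ t * k (x - t) :=
        h.contDiff.continuous.mul (hk.comp (continuous_const.sub continuous_id))
      exact this.integrable_of_hasCompactSupport h.hasCompactSupport.mul_right
    · exact h.integrable.const_mul _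
  have h2 : ∫ t, M * θ t = M := by rw [integral_const_mul, h.integral_eq_one, mul_one]
  rw [h1, ← h2, ← Real.norm_eq_abs]
  refine norm_integral_le_of_norm_le (h.integrable.const_mul _) (Eventually.of_forall fun t => ?_)
  rw [norm_mul, Real.norm_of_nonneg (h.nonneg t)]
  by_cases ht : ε < ‖t‖
  · simp [h.eq_zero ht]
  · refine mul_le_mul_of_nonneg_right (hM _ ?_) (h.nonneg t)
    simpa using ht

/-- The linear Taylor term is odd and the mollifier even, so it integrates to zero. Only the
first-order remainder is left, which gains the factor ε over the oscillation M of the derivative. -/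
theorem IsMollifier.abs_mollify_sub_le_of_fderiv {C ε M : ℝ} {θ f : ℝ × ℂ → ℝ}
    (h : IsMollifier C ε θ) (hf : ContDiff ℝ 1 f) {x : ℝ × ℂ} (hε : 0 ≤ ε)
    (hM : ∀ y ∈ Metric.closedBall x ε, ‖fderiv ℝ f y - fderiv ℝ f x‖ ≤ M) :
    |mollify f θ x - f x| ≤ M * ε := by
  set D := fderiv ℝ f x with hD
  have hM0 : 0 ≤ M := by
    exact (norm_nonneg _).trans (hM x (Metric.mem_closedBall_self hε))
  set k : ℝ × ℂ → ℝ := fun y => f y - D (y - x) with hk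
  have hkc : Continuous k := hf.continuous.sub (D.continuous.comp (continuous_id.sub continuous_const))
  have h1 := h.abs_mollify_sub_le (k := k) (x := x) (M := M * ε) hkc (by
    intro y hy
    have := Convex.norm_image_sub_le_of_norm_hasFDerivWithin_le' (f := f) (f' := fderiv ℝ f)
      (s := Metric.closedBall x ε) (φ := D) (C := M) (x := x) (y := y)
      (fun z _ => (hf.differentiable one_ne_zero z).hasFDerivAt.hasFDerivWithinAt) hM
      (convex_closedBall _ _) (Metric.mem_closedBall_self hε) hy
    have h3 : k y - k x = f y - f x - D (y - x) := by simp [hk]; ring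
    rw [h3, ← Real.norm_eq_abs]
    refine this.trans ?_
    rw [← dist_eq_norm]
    exact mul_le_mul_of_nonneg_left hy hM0)
  have hkx : k x = f x := by simp [hk]
  have hodd : ∫ t, θ t * D t = 0 := by
    have := integral_neg_eq_self (fun t => θ t * D t) volume
    simp only [h.neg, map_neg, mul_neg, integral_neg] at this
    linarith
  have h2 : mollify k θ x = mollify f θ x := by
    rw [mollify_comm, mollify_comm f, mollify, mollify]
    have i1 : Integrable fun t => θ t * f (x - t) :=
      (h.contDiff.continuous.mul (hf.continuous.comp
        (continuous_const.sub continuous_id))).integrable_of_hasCompactSupport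
        h.hasCompactSupport.mul_right
    have i2 : Integrable fun t => θ t * D t :=
      (h.contDiff.continuous.mul D.continuous).integrable_of_hasCompactSupport
        h.hasCompactSupport.mul_right
    have : (fun t => θ t * k (x - t)) = fun t => θ t * f (x - t) + θ t * D t := by
      ext t; simp [hk]; ring
    rw [this, integral_add i1 i2, hodd, add_zero]
  rwa [h2, hkx] at h1

theorem IsMollifier.abs_fderiv_mollify_sub_le {C ε M : ℝ} {θ f : ℝ × ℂ → ℝ}
    (h : IsMollifier C ε θ) (hf : ContDiff ℝ 1 f) (hfc : HasCompactSupport f) {x : ℝ × ℂ}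
    (hM : ∀ y ∈ Metric.closedBall x ε, ‖fderiv ℝ f y - fderiv ℝ f x‖ ≤ M) (e : ℝ × ℂ) :
    |fderiv ℝ (mollify f θ) x e - fderiv ℝ f x e| ≤ M * ‖e‖ := by
  rw [mollify_comm, fderiv_mollify_right h.contDiff.continuous.locallyIntegrable hf hfc,
    mollify_comm]
  refine h.abs_mollify_sub_le (k := fun y => fderiv ℝ f y e)
    ((hf.continuous_fderiv one_ne_zero).clm_apply continuous_const) fun y hy => ?_
  rw [← sub_apply, ← Real.norm_eq_abs]
  exact ((fderiv ℝ f y - fderiv ℝ f x).le_opNorm e).trans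
    (mul_le_mul_of_nonneg_right (hM y hy) (norm_nonneg _))

/-- Hölder's inequality on a ball of volume proportional to ε³. For p = ∞ the conventions ∞.toReal =
0 and 1/0 = 0 give the correct exponent 3. -/
theorem exists_integral_norm_closedBall_le {V : Set (ℝ × ℂ)} {p : ℝ≥0∞} (hp : 1 ≤ p)
    {k : ℝ × ℂ → ℝ} (hk : MemLp k p (volume.restrict V)) :
    ∃ B : ℝ, 0 ≤ B ∧ ∀ (x : ℝ × ℂ) (ε : ℝ), 0 < ε →
      Metric.closedBall x ε ⊆ V →
      ∫ t in Metric.closedBall x ε, |k t| ≤ B * ε ^ (3 * (1 - 1 / p.toReal)) := by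
  set v : ℝ := volume.real (Metric.ball (0 : ℝ × ℂ) 1) with hv
  refine ⟨(eLpNorm k p (volume.restrict V)).toReal * v ^ (1 - 1 / p.toReal), by positivity,
    fun x ε hε hx => ?_⟩
  have hp1 : 0 ≤ 1 - 1 / p.toReal := by
    rcases eq_or_ne p ⊤ with rfl | htop
    · simp
    · have : 1 ≤ p.toReal := by
        rw [← ENNReal.toReal_one]; exact ENNReal.toReal_mono htop hp
      have := div_le_one_of_le₀ this (by positivity)
      linarith
  have hmono : volume.restrict (Metric.closedBall x ε) ≤ volume.restrict V :=
    Measure.restrict_mono hx le_rfl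
  have hm : AEStronglyMeasurable k (volume.restrict (Metric.closedBall x ε)) :=
    hk.1.mono_measure hmono
  have hball : volume (Metric.closedBall x ε) =
      ENNReal.ofReal (ε ^ 3) * volume (Metric.ball (0 : ℝ × ℂ) 1) := by
    have h3 : Module.finrank ℝ (ℝ × ℂ) = 3 := by simp
    rw [Measure.addHaar_closedBall _ _ hε.le, h3]
  have hb : (volume (Metric.closedBall x ε)).toReal = ε ^ 3 * v := by
    rw [hball, ENNReal.toReal_mul, ENNReal.toReal_ofReal (by positivity), hv, measureReal_def]
  have key := eLpNorm_le_eLpNorm_mul_rpow_measure_univ hp hm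
  simp only [Measure.restrict_apply MeasurableSet.univ, univ_inter, ENNReal.toReal_one,
    div_one] at key
  have hfin : eLpNorm k p (volume.restrict V) ≠ ⊤ := hk.2.ne
  have hle : eLpNorm k 1 (volume.restrict (Metric.closedBall x ε)) ≤
      eLpNorm k p (volume.restrict V) *
        volume (Metric.closedBall x ε) ^ (1 - 1 / p.toReal) :=
    key.trans (mul_le_mul_left (eLpNorm_mono_measure _ hmono) _)
  have hfin2 : eLpNorm k p (volume.restrict V) *
        volume (Metric.closedBall x ε) ^ (1 - 1 / p.toReal) ≠ ⊤ :=
    ENNReal.mul_ne_top hfin (ENNReal.rpow_ne_top_of_nonneg hp1 measure_closedBall_lt_top.ne)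
  have h1 : ∫ t in Metric.closedBall x ε, |k t| =
      (eLpNorm k 1 (volume.restrict (Metric.closedBall x ε))).toReal := by
    rw [eLpNorm_one_eq_lintegral_enorm, ← integral_norm_eq_lintegral_enorm hm]
    rfl
  rw [h1]
  refine (ENNReal.toReal_mono hfin2 hle).trans (le_of_eq ?_)
  rw [ENNReal.toReal_mul, ← ENNReal.toReal_rpow, hb, Real.mul_rpow (by positivity) (by positivity),
    ← Real.rpow_natCast, ← Real.rpow_mul hε.le]
  push_cast
  ring

theorem IsMollifier.exists_integral_abs_mul_le {V : Set (ℝ × ℂ)} {p : ℝ≥0∞} (hp : 1 ≤ p)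
    {C : ℝ} (hC : 0 ≤ C) {k : ℝ × ℂ → ℝ} (hk : MemLp k p (volume.restrict V)) :
    ∃ B : ℝ, 0 ≤ B ∧ ∀ (x : ℝ × ℂ) (ε : ℝ) (θ : ℝ × ℂ → ℝ), 0 < ε → IsMollifier C ε θ →
      Metric.closedBall x ε ⊆ V →
      ∫ t in V, |k t| * θ (x - t) ≤ B * ε ^ (-(3 * (1 / p.toReal))) := by
  obtain ⟨B, hB, h⟩ := exists_integral_norm_closedBall_le hp hk
  refine ⟨C * B, by positivity, fun x ε θ hε hθ hx => ?_⟩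
  have hloc : IntegrableOn k (Metric.closedBall x ε) := by
    have : Fact (volume (Metric.closedBall x ε) < ⊤) := ⟨measure_closedBall_lt_top⟩
    exact MemLp.integrable hp (hk.mono_measure (Measure.restrict_mono hx le_rfl))
  have hzero : ∀ t, t ∉ Metric.closedBall x ε → |k t| * θ (x - t) = 0 := by
    intro t ht
    rw [hθ.eq_zero, mul_zero]
    simpa [dist_eq_norm, norm_sub_rev] using ht
  have h1 : ∫ t in V, |k t| * θ (x - t) = ∫ t in Metric.closedBall x ε, |k t| * θ (x - t) := by
    rw [setIntegral_eq_integral_of_forall_compl_eq_zero (fun t ht => hzero t ht),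
      setIntegral_eq_integral_of_forall_compl_eq_zero (fun t ht => hzero t (fun h => ht (hx h)))]
  rw [h1]
  calc ∫ t in Metric.closedBall x ε, |k t| * θ (x - t)
      ≤ ∫ t in Metric.closedBall x ε, C / ε ^ 3 * |k t| := by
        refine integral_mono_of_nonneg
          (Eventually.of_forall fun t => mul_nonneg (abs_nonneg _) (hθ.nonneg _))
          (hloc.abs.const_mul _) (Eventually.of_forall fun t => ?_)
        beta_reduce
        rw [mul_comm]
        exact mul_le_mul_of_nonneg_right (hθ.le _) (abs_nonneg _)
    _ ≤ C / ε ^ 3 * (B * ε ^ (3 * (1 - 1 / p.toReal))) := by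
        rw [integral_const_mul]
        exact mul_le_mul_of_nonneg_left (h x ε hε hx) (by positivity)
    _ = C * B * ε ^ (-(3 * (1 / p.toReal))) := by
        have : ε ^ (3 * (1 - 1 / p.toReal)) = ε ^ 3 * ε ^ (-(3 * (1 / p.toReal))) := by
          rw [← Real.rpow_natCast, ← Real.rpow_add hε]
          congr 1; push_cast; ring
        rw [this]
        field_simp

/-! ### The Levi form of a graph -/

/-- Four times the Levi form at `(W₁, W₂)` of `(z₁, z₂) ↦ v (y₁, z₂)`, in terms of the second
derivatives `m₀ = v_{y₁y₁}`, `m₁ = v_{y₁x₂}`, `m₂ = v_{y₁y₂}`, `m₃ = v_{x₂x₂}`, `m₄ = v_{y₂y₂}`. -/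
noncomputable def leviQ (W₁ W₂ : ℂ) (m₀ m₁ m₂ m₃ m₄ : ℝ) : ℝ :=
  ‖W₁‖ ^ 2 * m₀ + 2 * (m₁ * (Complex.I * conj W₁ * W₂).re + m₂ * (Complex.I * conj W₁ * W₂).im)
    + ‖W₂‖ ^ 2 * (m₃ + m₄)

/-- The Levi form is the trace of the real Hessian over a complex line, that is, its sum over W and
iW. -/
theorem bilinear_add_bilinear_eq_leviQ (B : ℝ × ℂ →L[ℝ] ℝ × ℂ →L[ℝ] ℝ)
    (hB : ∀ u v, B u v = B v u) (W₁ W₂ : ℂ) :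
    B (W₁.im, W₂) (W₁.im, W₂) +
        B ((W₁ * Complex.I).im, W₂ * Complex.I) ((W₁ * Complex.I).im, W₂ * Complex.I) =
      leviQ W₁ W₂ (B dirY1 dirY1) (B dirX2 dirY1) (B dirY2 dirY1) (B dirX2 dirX2)
        (B dirY2 dirY2) := by
  have hdec : ∀ (s : ℝ) (z : ℂ), ((s, z) : ℝ × ℂ) = s • dirY1 + z.re • dirX2 + z.im • dirY2 := by
    intro s z
    refine Prod.ext ?_ (Complex.ext ?_ ?_) <;> simp [dirY1, dirX2, dirY2]
  rw [hdec W₁.im W₂, hdec (W₁ * Complex.I).im]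
  simp only [map_add, map_smul, add_apply, smul_apply, smul_eq_mul]
  rw [hB dirY1 dirX2, hB dirY1 dirY2, hB dirY2 dirX2, leviQ, ← Complex.normSq_eq_norm_sq,
    ← Complex.normSq_eq_norm_sq, Complex.normSq_apply, Complex.normSq_apply]
  simp
  ring

theorem leviQ_mul_mul (l W₁ W₂ : ℂ) (m₀ m₁ m₂ m₃ m₄ : ℝ) :
    leviQ (l * W₁) (l * W₂) m₀ m₁ m₂ m₃ m₄ = ‖l‖ ^ 2 * leviQ W₁ W₂ m₀ m₁ m₂ m₃ m₄ := by
  have h : Complex.I * conj (l * W₁) * (l * W₂) = (‖l‖ ^ 2 : ℝ) * (Complex.I * conj W₁ * W₂) := by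
    rw [← Complex.normSq_eq_norm_sq, Complex.normSq_eq_conj_mul_self, map_mul]; ring
  rw [leviQ, leviQ, h, Complex.re_ofReal_mul, Complex.im_ofReal_mul, norm_mul, norm_mul]
  ring

/-- For τ = τ(φ) the vector (-2τ₁, τ₂) spans the kernel of ∂(x₁ - φ), so Δ_τ φ is a quarter of the
Levi form on a complex tangent vector. -/
theorem leviQ_eq_four_mul_deltaOp (V : Set (ℝ × ℂ)) (τ : ℝ × ℂ → ℂ × ℂ) (v : ℝ × ℂ → ℝ)
    (t : ℝ × ℂ) :
    leviQ (-2 * (τ t).1) (τ t).2 (weakDeriv V dirY1 (weakDeriv V dirY1 v) t)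
      (weakDeriv V dirY1 (weakDeriv V dirX2 v) t) (weakDeriv V dirY1 (weakDeriv V dirY2 v) t)
      (weakDeriv V dirX2 (weakDeriv V dirX2 v) t) (weakDeriv V dirY2 (weakDeriv V dirY2 v) t) =
      4 * deltaOp V τ v t := by
  simp only [deltaOp, leviQ, dY1Y1, dY1Zbar2, dZ2Zbar2]
  generalize weakDeriv V dirY1 (weakDeriv V dirY1 v) t = m₀
  generalize weakDeriv V dirY1 (weakDeriv V dirX2 v) t = m₁
  generalize weakDeriv V dirY1 (weakDeriv V dirY2 v) t = m₂
  generalize weakDeriv V dirX2 (weakDeriv V dirX2 v) t = m₃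
  generalize weakDeriv V dirY2 (weakDeriv V dirY2 v) t = m₄
  generalize (τ t).1 = a
  generalize (τ t).2 = b
  rw [norm_mul]
  simp
  ring

/-- Only the first component varies, so m₃ and m₄ cancel. -/
theorem leviQ_sub_leviQ_le (a b W : ℂ) (m₀ m₁ m₂ m₃ m₄ : ℝ) :
    leviQ a W m₀ m₁ m₂ m₃ m₄ - leviQ b W m₀ m₁ m₂ m₃ m₄ ≤
      ‖a - b‖ * (‖a‖ + ‖b‖) * |m₀| + 2 * (‖a - b‖ * ‖W‖) * (|m₁| + |m₂|) := by
  have h0 : (‖a‖ ^ 2 - ‖b‖ ^ 2) * m₀ ≤ ‖a - b‖ * (‖a‖ + ‖b‖) * |m₀| := by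
    have h1 : |‖a‖ ^ 2 - ‖b‖ ^ 2| ≤ ‖a - b‖ * (‖a‖ + ‖b‖) := by
      have : ‖a‖ ^ 2 - ‖b‖ ^ 2 = (‖a‖ - ‖b‖) * (‖a‖ + ‖b‖) := by ring
      rw [this, abs_mul, abs_of_nonneg (a := ‖a‖ + ‖b‖) (by positivity)]
      exact mul_le_mul_of_nonneg_right (abs_norm_sub_norm_le a b) (by positivity)
    calc _ ≤ |(‖a‖ ^ 2 - ‖b‖ ^ 2) * m₀| := le_abs_self _
      _ = |‖a‖ ^ 2 - ‖b‖ ^ 2| * |m₀| := abs_mul _ _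
      _ ≤ _ := mul_le_mul_of_nonneg_right h1 (abs_nonneg _)
  set d : ℂ := Complex.I * conj (a - b) * W with hd
  have hdn : ‖d‖ = ‖a - b‖ * ‖W‖ := by rw [hd]; simp [-map_sub]
  have hdr : (Complex.I * conj a * W).re - (Complex.I * conj b * W).re = d.re := by
    rw [hd, ← Complex.sub_re, map_sub]; ring_nf
  have hdi : (Complex.I * conj a * W).im - (Complex.I * conj b * W).im = d.im := by
    rw [hd, ← Complex.sub_im, map_sub]; ring_nf
  have h1 : m₁ * d.re ≤ |m₁| * (‖a - b‖ * ‖W‖) := by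
    rw [← hdn]
    calc _ ≤ |m₁ * d.re| := le_abs_self _
      _ = |m₁| * |d.re| := abs_mul _ _
      _ ≤ _ := mul_le_mul_of_nonneg_left (Complex.abs_re_le_norm d) (abs_nonneg _)
  have h2 : m₂ * d.im ≤ |m₂| * (‖a - b‖ * ‖W‖) := by
    rw [← hdn]
    calc _ ≤ |m₂ * d.im| := le_abs_self _
      _ = |m₂| * |d.im| := abs_mul _ _
      _ ≤ _ := mul_le_mul_of_nonneg_left (Complex.abs_im_le_norm d) (abs_nonneg _)
  rw [← hdr] at h1
  rw [← hdi] at h2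
  unfold leviQ
  linarith

/-- A vector W that is complex tangent up to η is within 2η of an exact tangent vector with the same
second component, on which the Levi form is nonpositive. The cost is linear in η and in the second
derivatives. -/
theorem leviQ_le_of_deltaOp_nonpos {V : Set (ℝ × ℂ)} {φ : ℝ × ℂ → ℝ} {t : ℝ × ℂ}
    (ht : deltaOp V (tauOf φ) φ t ≤ 0) {W₁ W₂ : ℂ} {η K : ℝ} (hη : η ≤ 1)
    (h1 : |W₁.re - fderiv ℝ φ t (W₁.im, W₂)| ≤ η)
    (hI : |(W₁ * Complex.I).re - fderiv ℝ φ t ((W₁ * Complex.I).im, W₂ * Complex.I)| ≤ η)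
    (hW₁ : ‖W₁‖ ≤ K) (hW₂ : ‖W₂‖ ≤ K) :
    leviQ W₁ W₂ (weakDeriv V dirY1 (weakDeriv V dirY1 φ) t)
      (weakDeriv V dirY1 (weakDeriv V dirX2 φ) t) (weakDeriv V dirY1 (weakDeriv V dirY2 φ) t)
      (weakDeriv V dirX2 (weakDeriv V dirX2 φ) t) (weakDeriv V dirY2 (weakDeriv V dirY2 φ) t) ≤
      (4 * K + 4) * η * (|weakDeriv V dirY1 (weakDeriv V dirY1 φ) t| +
        |weakDeriv V dirY1 (weakDeriv V dirX2 φ) t| +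
        |weakDeriv V dirY1 (weakDeriv V dirY2 φ) t|) := by
  have hq := leviQ_eq_four_mul_deltaOp V (tauOf φ) φ t
  have hη0 : 0 ≤ η := (abs_nonneg _).trans h1
  have hdec : ∀ (s : ℝ) (z : ℂ), ((s, z) : ℝ × ℂ) = s • dirY1 + z.re • dirX2 + z.im • dirY2 := by
    intro s z
    refine Prod.ext ?_ (Complex.ext ?_ ?_) <;> simp [dirY1, dirX2, dirY2]
  rw [hdec] at h1 hI
  simp only [map_add, map_smul, smul_eq_mul] at h1 hI
  have hτ1 : (tauOf φ t).1 = -(1 / 2) *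
    (((fderiv ℝ φ t dirX2 : ℂ) - Complex.I * (fderiv ℝ φ t dirY2 : ℂ)) / 2) := rfl
  have hτ2 : (tauOf φ t).2 = (1 / 2) * (1 + Complex.I * (fderiv ℝ φ t dirY1 : ℂ)) := rfl
  set a := (tauOf φ t).1
  set b := (tauOf φ t).2
  have hb : 1 / 2 ≤ ‖b‖ := by
    refine le_trans ?_ (Complex.abs_re_le_norm b)
    rw [hτ2]; norm_num
  have hb0 : b ≠ 0 := by
    intro h0; rw [h0, norm_zero] at hb; norm_num at hb
  -- A is ∂(x₁ - φ) applied to W. Its real and imaginary parts are, up to sign, half the real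
  -- differential of x₁ - φ at W and at iW.
  set A := b * W₁ + 2 * a * W₂ with hA
  have hAn : ‖A‖ ≤ η := by
    have hr : A.re = (W₁.re - (W₁.im * fderiv ℝ φ t dirY1 + W₂.re * fderiv ℝ φ t dirX2 +
        W₂.im * fderiv ℝ φ t dirY2)) / 2 := by
      rw [hA, hτ1, hτ2]; simp; ring
    have hi : A.im = -((W₁ * Complex.I).re - ((W₁ * Complex.I).im * fderiv ℝ φ t dirY1 +
        (W₂ * Complex.I).re * fderiv ℝ φ t dirX2 +
        (W₂ * Complex.I).im * fderiv ℝ φ t dirY2)) / 2 := by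
      rw [hA, hτ1, hτ2]; simp; ring
    refine (Complex.norm_le_abs_re_add_abs_im A).trans ?_
    rw [hr, hi, abs_div, abs_div, abs_neg, abs_two]
    linarith
  -- The vector (u, W₂) is the multiple of the tangent vector (-2a, b) whose second component is W₂.
  set u := W₂ / b * (-2 * a) with hu
  have hdiff : ‖W₁ - u‖ ≤ 2 * η := by
    have : W₁ - u = A / b := by rw [hu, hA]; field_simp; ring
    rw [this, norm_div, div_le_iff₀ (by linarith)]
    nlinarith
  have hun : ‖u‖ ≤ K + 2 := by
    have := norm_sub_norm_le u W₁
    rw [norm_sub_rev] at this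
    linarith
  have h2 := leviQ_sub_leviQ_le W₁ u W₂ (weakDeriv V dirY1 (weakDeriv V dirY1 φ) t)
      (weakDeriv V dirY1 (weakDeriv V dirX2 φ) t) (weakDeriv V dirY1 (weakDeriv V dirY2 φ) t)
      (weakDeriv V dirX2 (weakDeriv V dirX2 φ) t) (weakDeriv V dirY2 (weakDeriv V dirY2 φ) t)
  have h3 : leviQ u W₂ (weakDeriv V dirY1 (weakDeriv V dirY1 φ) t)
      (weakDeriv V dirY1 (weakDeriv V dirX2 φ) t) (weakDeriv V dirY1 (weakDeriv V dirY2 φ) t)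
      (weakDeriv V dirX2 (weakDeriv V dirX2 φ) t) (weakDeriv V dirY2 (weakDeriv V dirY2 φ) t)
      ≤ 0 := by
    have hW : W₂ = W₂ / b * b := by field_simp
    rw [hu]
    nth_rewrite 2 [hW]
    rw [leviQ_mul_mul, hq]
    exact mul_nonpos_of_nonneg_of_nonpos (by positivity) (by linarith)
  have hK : 0 ≤ K := (norm_nonneg _).trans hW₁
  have h4 : ‖W₁ - u‖ * (‖W₁‖ + ‖u‖) ≤ (4 * K + 4) * η := by
    calc _ ≤ (2 * η) * (K + (K + 2)) := by gcongr
      _ = _ := by ring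
  have h5 : 2 * (‖W₁ - u‖ * ‖W₂‖) ≤ (4 * K + 4) * η := by
    calc _ ≤ 2 * ((2 * η) * K) := by gcongr
      _ ≤ _ := by nlinarith
  have h6 := mul_le_mul_of_nonneg_right h4
    (abs_nonneg (weakDeriv V dirY1 (weakDeriv V dirY1 φ) t))
  have h7 := mul_le_mul_of_nonneg_right h5
    (add_nonneg (abs_nonneg (weakDeriv V dirY1 (weakDeriv V dirX2 φ) t))
      (abs_nonneg (weakDeriv V dirY1 (weakDeriv V dirY2 φ) t)))
  linarith

/-! ### The second derivative test along a holomorphic disc -/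

/-- A positive second derivative would make x a local minimum too, so κ would be locally constant
and the second derivative zero. -/
theorem IsLocalMax.deriv_eq_zero_and_deriv_deriv_nonpos {κ κ' : ℝ → ℝ} {κ'' x : ℝ}
    (h : IsLocalMax κ x) (h1 : ∀ t, HasDerivAt κ (κ' t) t) (h2 : HasDerivAt κ' κ'' x) :
    κ' x = 0 ∧ κ'' ≤ 0 := by
  have hd : deriv κ = κ' := funext fun t => (h1 t).deriv
  have h0 : κ' x = 0 := h.hasDerivAt_eq_zero (h1 x)
  refine ⟨h0, ?_⟩
  by_contra! hpos
  have hmin : IsLocalMin κ x := isLocalMin_of_deriv_deriv_pos (by rw [hd, h2.deriv]; exact hpos)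
    (by rw [hd, h0]) (h1 x).continuousAt
  have hconst : κ =ᶠ[𝓝 x] fun _ => κ x := by
    filter_upwards [h, hmin] with t ht ht' using le_antisymm ht ht'
  have hκ' : κ' =ᶠ[𝓝 x] fun _ => 0 := by
    have := hconst.deriv
    rw [hd] at this
    simpa using this
  have := hκ'.deriv_eq
  rw [h2.deriv] at this
  simp at this
  linarith

theorem second_derivative_test_disc {F : ℝ × ℂ → ℝ} (hF : ContDiff ℝ ∞ F) {q₁ q₂ : ℂ → ℂ}
    (hq₁ : Differentiable ℂ q₁) (hq₂ : Differentiable ℂ q₂) {z z₀ : ℂ} {c : ℝ}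
    (hmax : IsLocalMax (fun ζ => (q₁ ζ).re - F ((q₁ ζ).im, q₂ ζ) + c * ‖ζ - z₀‖ ^ 2) z)
    {v : ℂ} (hv : ‖v‖ = 1) :
    (deriv q₁ z * v).re - fderiv ℝ F ((q₁ z).im, q₂ z) ((deriv q₁ z * v).im, deriv q₂ z * v)
        + 2 * c * (conj (z - z₀) * v).re = 0 ∧
      (deriv (deriv q₁) z * v ^ 2).re
        - fderiv ℝ (fderiv ℝ F) ((q₁ z).im, q₂ z) ((deriv q₁ z * v).im, deriv q₂ z * v)
            ((deriv q₁ z * v).im, deriv q₂ z * v)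
        - fderiv ℝ F ((q₁ z).im, q₂ z)
            ((deriv (deriv q₁) z * v ^ 2).im, deriv (deriv q₂) z * v ^ 2)
        + 2 * c ≤ 0 := by
  have hline : ∀ t : ℝ, HasDerivAt (fun s : ℂ => z + s * v) v (t : ℂ) := fun t => by
    simpa using ((hasDerivAt_id (t : ℂ)).mul_const v).const_add z
  have hcomp : ∀ {q : ℂ → ℂ}, Differentiable ℂ q → ∀ t : ℝ,
      HasDerivAt (fun s : ℝ => q (z + s * v)) (deriv q (z + t * v) * v) t := fun {q} hq t =>
    ((hq (z + t * v)).hasDerivAt.comp (t : ℂ) (hline t)).comp_ofReal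
  have hre : ∀ {g : ℝ → ℂ} {g' : ℂ} {t : ℝ}, HasDerivAt g g' t →
      HasDerivAt (fun s => (g s).re) g'.re t := fun h =>
    Complex.reCLM.hasFDerivAt.comp_hasDerivAt _ h
  have him : ∀ {g : ℝ → ℂ} {g' : ℂ} {t : ℝ}, HasDerivAt g g' t →
      HasDerivAt (fun s => (g s).im) g'.im t := fun h =>
    Complex.imCLM.hasFDerivAt.comp_hasDerivAt _ h
  have hdq : ∀ {q : ℂ → ℂ}, Differentiable ℂ q → Differentiable ℂ (deriv q) := fun hq =>
    differentiableOn_univ.1 (hq.differentiableOn.deriv isOpen_univ)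
  have hy : ∀ t : ℝ, HasDerivAt (fun s : ℝ => ((q₁ (z + s * v)).im, q₂ (z + s * v)))
      ((deriv q₁ (z + t * v) * v).im, deriv q₂ (z + t * v) * v) t := fun t =>
    (him (hcomp hq₁ t)).prodMk (hcomp hq₂ t)
  have hy' : HasDerivAt (fun s : ℝ => ((deriv q₁ (z + s * v) * v).im, deriv q₂ (z + s * v) * v))
      ((deriv (deriv q₁) z * v ^ 2).im, deriv (deriv q₂) z * v ^ 2) 0 := by
    have h1 := him ((hcomp (hdq hq₁) 0).mul_const v)
    have h2 := (hcomp (hdq hq₂) 0).mul_const v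
    have := h1.prodMk h2
    simpa [mul_assoc, pow_two] using this
  have hFd : ∀ x, HasFDerivAt F (fderiv ℝ F x) x := fun x =>
    (hF.differentiable (by simp) x).hasFDerivAt
  have hFd' : ∀ x, HasFDerivAt (fderiv ℝ F) (fderiv ℝ (fderiv ℝ F) x) x := fun x =>
    ((hF.fderiv_right (m := ∞) (by norm_num)).differentiable (by simp) x).hasFDerivAt
  have hnorm : ∀ t : ℝ, c * ‖z + t * v - z₀‖ ^ 2 =
      c * ‖z - z₀‖ ^ 2 + 2 * c * (conj (z - z₀) * v).re * t + c * t ^ 2 := by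
    intro t
    have h1 : ‖v‖ ^ 2 = 1 := by rw [hv]; norm_num
    rw [← Complex.normSq_eq_norm_sq, Complex.normSq_apply] at h1 ⊢
    rw [← Complex.normSq_eq_norm_sq, Complex.normSq_apply]
    simp
    linear_combination (c * t ^ 2) * h1
  set κ : ℝ → ℝ := fun t => (q₁ (z + t * v)).re - F ((q₁ (z + t * v)).im, q₂ (z + t * v)) +
    c * ‖z + t * v - z₀‖ ^ 2 with hκ
  set κ' : ℝ → ℝ := fun t => (deriv q₁ (z + t * v) * v).re
    - fderiv ℝ F ((q₁ (z + t * v)).im, q₂ (z + t * v))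
      ((deriv q₁ (z + t * v) * v).im, deriv q₂ (z + t * v) * v) +
    (2 * c * (conj (z - z₀) * v).re + 2 * c * t) with hκ'
  have hκd : ∀ t, HasDerivAt κ (κ' t) t := by
    intro t
    have h3 : HasDerivAt (fun t : ℝ => c * ‖z + t * v - z₀‖ ^ 2)
        (2 * c * (conj (z - z₀) * v).re + 2 * c * t) t := by
      simp only [hnorm]
      have := (((hasDerivAt_id t).const_mul (2 * c * (conj (z - z₀) * v).re)).const_add
        (c * ‖z - z₀‖ ^ 2)).add (((hasDerivAt_id t).pow 2).const_mul c)
      refine this.congr_deriv ?_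
      simp; ring
    exact ((hre (hcomp hq₁ t)).sub ((hFd _).comp_hasDerivAt t (hy t))).add h3
  have hκd' : HasDerivAt κ' ((deriv (deriv q₁) z * v ^ 2).re
        - (fderiv ℝ (fderiv ℝ F) ((q₁ z).im, q₂ z) ((deriv q₁ z * v).im, deriv q₂ z * v)
            ((deriv q₁ z * v).im, deriv q₂ z * v)
        + fderiv ℝ F ((q₁ z).im, q₂ z)
            ((deriv (deriv q₁) z * v ^ 2).im, deriv (deriv q₂) z * v ^ 2))
        + 2 * c) 0 := by
    have h1 : HasDerivAt (fun t : ℝ => (deriv q₁ (z + t * v) * v).re)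
        (deriv (deriv q₁) z * v ^ 2).re 0 := by
      have := hre ((hcomp (hdq hq₁) 0).mul_const v)
      simpa [mul_assoc, pow_two] using this
    have h2 := ((hFd' _).comp_hasDerivAt (0 : ℝ) (hy 0)).clm_apply hy'
    have h3 : HasDerivAt (fun t : ℝ => 2 * c * (conj (z - z₀) * v).re + 2 * c * t) (2 * c) 0 := by
      simpa using ((hasDerivAt_id (0 : ℝ)).const_mul (2 * c)).const_add
        (2 * c * (conj (z - z₀) * v).re)
    refine ((h1.sub h2).add h3).congr_deriv ?_
    simp
  have hloc : IsLocalMax κ 0 := by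
    have hcont : Tendsto (fun t : ℝ => z + t * v) (𝓝 0) (𝓝 z) := by
      have : Continuous fun t : ℝ => z + t * v := by fun_prop
      simpa using this.tendsto 0
    have := hcont.eventually hmax
    filter_upwards [this] with t ht
    simpa [hκ] using ht
  obtain ⟨e1, e2⟩ := hloc.deriv_eq_zero_and_deriv_deriv_nonpos hκd hκd'
  constructor
  · simpa [hκ'] using e1
  · linarith

/-- Add the second derivative tests in the directions 1 and i. The terms with q'' carry v² = ±1 and
cancel, which leaves the Levi form of F on q' and the Laplacian 4c of the quadratic term. -/
theorem laplacian_test_disc {F : ℝ × ℂ → ℝ} (hF : ContDiff ℝ ∞ F) {q₁ q₂ : ℂ → ℂ}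
    (hq₁ : Differentiable ℂ q₁) (hq₂ : Differentiable ℂ q₂) {z z₀ : ℂ} {c : ℝ}
    (hmax : IsLocalMax (fun ζ => (q₁ ζ).re - F ((q₁ ζ).im, q₂ ζ) + c * ‖ζ - z₀‖ ^ 2) z) :
    4 * c ≤ leviQ (deriv q₁ z) (deriv q₂ z)
      (fderiv ℝ (fderiv ℝ F) ((q₁ z).im, q₂ z) dirY1 dirY1)
      (fderiv ℝ (fderiv ℝ F) ((q₁ z).im, q₂ z) dirX2 dirY1)
      (fderiv ℝ (fderiv ℝ F) ((q₁ z).im, q₂ z) dirY2 dirY1)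
      (fderiv ℝ (fderiv ℝ F) ((q₁ z).im, q₂ z) dirX2 dirX2)
      (fderiv ℝ (fderiv ℝ F) ((q₁ z).im, q₂ z) dirY2 dirY2) := by
  have h1 := (second_derivative_test_disc hF hq₁ hq₂ hmax (v := 1) (by simp)).2
  have h2 := (second_derivative_test_disc hF hq₁ hq₂ hmax (v := Complex.I) (by simp)).2
  have hsymm : ∀ u v, fderiv ℝ (fderiv ℝ F) ((q₁ z).im, q₂ z) u v =
      fderiv ℝ (fderiv ℝ F) ((q₁ z).im, q₂ z) v u := fun u v =>
    hF.contDiffAt.isSymmSndFDerivAt (by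
      rw [minSmoothness_of_isRCLikeNormedField]; exact WithTop.coe_le_coe.2 le_top) u v
  rw [← bilinear_add_bilinear_eq_leviQ _ hsymm]
  have hneg : fderiv ℝ F ((q₁ z).im, q₂ z)
      ((deriv (deriv q₁) z * Complex.I ^ 2).im, deriv (deriv q₂) z * Complex.I ^ 2) =
      -fderiv ℝ F ((q₁ z).im, q₂ z) ((deriv (deriv q₁) z * 1 ^ 2).im, deriv (deriv q₂) z * 1 ^ 2) := by
    rw [← map_neg]; simp
  rw [hneg] at h2
  simp only [mul_one, one_pow, Complex.I_sq, mul_neg, Complex.neg_re] at h1 h2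
  linarith

theorem abs_gradient_test_disc {F : ℝ × ℂ → ℝ} (hF : ContDiff ℝ ∞ F) {q₁ q₂ : ℂ → ℂ}
    (hq₁ : Differentiable ℂ q₁) (hq₂ : Differentiable ℂ q₂) {z z₀ : ℂ} {c : ℝ} (hc : 0 ≤ c)
    (hmax : IsLocalMax (fun ζ => (q₁ ζ).re - F ((q₁ ζ).im, q₂ ζ) + c * ‖ζ - z₀‖ ^ 2) z)
    {v : ℂ} (hv : ‖v‖ = 1) :
    |(deriv q₁ z * v).re -
      fderiv ℝ F ((q₁ z).im, q₂ z) ((deriv q₁ z * v).im, deriv q₂ z * v)| ≤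
      2 * c * ‖z - z₀‖ := by
  have h := (second_derivative_test_disc hF hq₁ hq₂ hmax hv).1
  have h1 : |(conj (z - z₀) * v).re| ≤ ‖z - z₀‖ := by
    refine (Complex.abs_re_le_norm _).trans ?_
    rw [norm_mul, hv, Complex.norm_conj, mul_one]
  rw [abs_le] at h1 ⊢
  constructor <;> nlinarith

/-! ### Analytic discs touching the graph -/

theorem exists_contDiff_hasCompactSupport_eq {φ : ℝ × ℂ → ℝ} {ξ : ℝ × ℂ} {R : ℝ} (hR : 0 < R)
    (hφ : ContDiffOn ℝ 1 φ (Metric.ball ξ (4 * R))) :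
    ∃ f : ℝ × ℂ → ℝ, ContDiff ℝ 1 f ∧ HasCompactSupport f ∧
      (∀ x ∈ Metric.closedBall ξ (2 * R), f x = φ x) ∧
      ∀ x ∈ Metric.closedBall ξ (2 * R), fderiv ℝ f x = fderiv ℝ φ x := by
  let χ : ContDiffBump ξ := ⟨5 / 2 * R, 3 * R, by positivity, by linarith⟩
  have heq : ∀ x ∈ Metric.ball ξ (5 / 2 * R), χ x * φ x = φ x := by
    intro x hx
    rw [χ.one_of_mem_closedBall (Metric.ball_subset_closedBall hx), one_mul]
  refine ⟨fun x => χ x * φ x, ?_, χ.hasCompactSupport.mul_right, fun x hx => heq x ?_,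
    fun x hx => Filter.EventuallyEq.fderiv_eq ?_⟩
  · rw [contDiff_iff_contDiffAt]
    intro x
    by_cases hx : x ∈ Metric.ball ξ (4 * R)
    · exact χ.contDiffAt.mul (hφ.contDiffAt (Metric.isOpen_ball.mem_nhds hx))
    · have : (fun x => χ x * φ x) =ᶠ[𝓝 x] fun _ => 0 := by
        have hx' : x ∈ (Metric.closedBall ξ (3 * R))ᶜ := by
          simp at hx ⊢; linarith
        filter_upwards [Metric.isClosed_closedBall.isOpen_compl.mem_nhds hx'] with y hy
        rw [χ.zero_of_le_dist, zero_mul]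
        simp at hy; exact hy.le
      exact contDiffAt_const.congr_of_eventuallyEq this
  · exact Metric.closedBall_subset_ball (by linarith) hx
  · have hx' : x ∈ Metric.ball ξ (5 / 2 * R) := Metric.closedBall_subset_ball (by linarith) hx
    filter_upwards [Metric.isOpen_ball.mem_nhds hx'] with y hy using heq y hy

theorem setIntegral_leviQ_mul {V : Set (ℝ × ℂ)} {m₀ m₁ m₂ m₃ m₄ θ : ℝ × ℂ → ℝ} (W₁ W₂ : ℂ)
    (h₀ : IntegrableOn (fun t => m₀ t * θ t) V) (h₁ : IntegrableOn (fun t => m₁ t * θ t) V)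
    (h₂ : IntegrableOn (fun t => m₂ t * θ t) V) (h₃ : IntegrableOn (fun t => m₃ t * θ t) V)
    (h₄ : IntegrableOn (fun t => m₄ t * θ t) V) :
    IntegrableOn (fun t => leviQ W₁ W₂ (m₀ t) (m₁ t) (m₂ t) (m₃ t) (m₄ t) * θ t) V ∧
    ∫ t in V, leviQ W₁ W₂ (m₀ t) (m₁ t) (m₂ t) (m₃ t) (m₄ t) * θ t =
      leviQ W₁ W₂ (∫ t in V, m₀ t * θ t) (∫ t in V, m₁ t * θ t) (∫ t in V, m₂ t * θ t)
        (∫ t in V, m₃ t * θ t) (∫ t in V, m₄ t * θ t) := by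
  set a := (Complex.I * conj W₁ * W₂).re with ha
  set b := (Complex.I * conj W₁ * W₂).im with hb
  have heq : (fun t => leviQ W₁ W₂ (m₀ t) (m₁ t) (m₂ t) (m₃ t) (m₄ t) * θ t) = fun t =>
      ‖W₁‖ ^ 2 * (m₀ t * θ t) + (2 * a * (m₁ t * θ t) + (2 * b * (m₂ t * θ t) +
        (‖W₂‖ ^ 2 * (m₃ t * θ t) + ‖W₂‖ ^ 2 * (m₄ t * θ t)))) := by
    ext t; simp only [leviQ]; rw [← ha, ← hb]; ring
  have i34 := (h₃.const_mul (‖W₂‖ ^ 2)).fun_add (h₄.const_mul (‖W₂‖ ^ 2))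
  have i2 := (h₂.const_mul (2 * b)).fun_add i34
  have i1 := (h₁.const_mul (2 * a)).fun_add i2
  rw [heq]
  refine ⟨(h₀.const_mul (‖W₁‖ ^ 2)).add i1, ?_⟩
  rw [integral_add (h₀.const_mul (‖W₁‖ ^ 2)) i1, integral_add (h₁.const_mul (2 * a)) i2,
    integral_add (h₂.const_mul (2 * b)) i34,
    integral_add (h₃.const_mul (‖W₂‖ ^ 2)) (h₄.const_mul (‖W₂‖ ^ 2)), integral_const_mul,
    integral_const_mul, integral_const_mul, integral_const_mul, integral_const_mul, leviQ, ← ha,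
    ← hb]
  ring

/-- For a fixed direction `leviQ` is linear in the second derivatives, so the mollified Levi form is
the average of the pointwise ones. The pointwise bound and the growth ε^(-3/p) of the averaged
second derivatives then combine. -/
theorem IsMollifier.exists_setIntegral_leviQ_le {V : Set (ℝ × ℂ)} (hV : IsOpen V)
    {φ : ℝ × ℂ → ℝ} {p : ℝ≥0∞} (hp : 1 ≤ p) (hφ : MemSobolev p V 2 φ) {C : ℝ} (hC : 0 ≤ C)
    (K : ℝ) :
    ∃ B : ℝ, 0 ≤ B ∧ ∀ (x : ℝ × ℂ) (ε η : ℝ) (f θ : ℝ × ℂ → ℝ) (W₁ W₂ : ℂ),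
      0 < ε → IsMollifier C ε θ → Metric.closedBall x ε ⊆ V → LocallyIntegrable f →
      (∀ t ∈ Metric.closedBall x ε, f t = φ t) → η ≤ 1 → 0 ≤ η → ‖W₁‖ ≤ K → ‖W₂‖ ≤ K →
      (∀ᵐ t, t ∈ Metric.closedBall x ε → deltaOp V (tauOf φ) φ t ≤ 0) →
      (∀ t ∈ Metric.closedBall x ε, |W₁.re - fderiv ℝ φ t (W₁.im, W₂)| ≤ η ∧
        |(W₁ * Complex.I).re - fderiv ℝ φ t ((W₁ * Complex.I).im, W₂ * Complex.I)| ≤ η) →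
      leviQ W₁ W₂ (fderiv ℝ (fderiv ℝ (mollify f θ)) x dirY1 dirY1)
        (fderiv ℝ (fderiv ℝ (mollify f θ)) x dirX2 dirY1)
        (fderiv ℝ (fderiv ℝ (mollify f θ)) x dirY2 dirY1)
        (fderiv ℝ (fderiv ℝ (mollify f θ)) x dirX2 dirX2)
        (fderiv ℝ (fderiv ℝ (mollify f θ)) x dirY2 dirY2) ≤
      B * η * ε ^ (-(3 * (1 / p.toReal))) := by
  obtain ⟨B₀, hB₀, h₀⟩ := IsMollifier.exists_integral_abs_mul_le hp hC
    (hφ.hasWeakDerivOn_weakDeriv hV dirY1 dirY1).2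
  obtain ⟨B₁, hB₁, h₁⟩ := IsMollifier.exists_integral_abs_mul_le hp hC
    (hφ.hasWeakDerivOn_weakDeriv hV dirX2 dirY1).2
  obtain ⟨B₂, hB₂, h₂⟩ := IsMollifier.exists_integral_abs_mul_le hp hC
    (hφ.hasWeakDerivOn_weakDeriv hV dirY2 dirY1).2
  refine ⟨(4 * |K| + 4) * (B₀ + B₁ + B₂), by positivity,
    fun x ε η f θ W₁ W₂ hε hθ hx hf hfφ hη1 hη0 hW₁ hW₂ hae hgrad => ?_⟩
  have hsec : ∀ e e', fderiv ℝ (fderiv ℝ (mollify f θ)) x e' e =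
      ∫ t in V, weakDeriv V e (weakDeriv V e' φ) t * θ (x - t) := fun e e' =>
    fderiv_fderiv_mollify_eq_integral hf hθ.contDiff hθ.hasCompactSupport hθ.tsupport_subset hx
      hfφ (MemSobolev.hasWeakDerivOn hφ e') (hφ.hasWeakDerivOn_weakDeriv hV e' e).1
  have hint : ∀ e e', Integrable (fun t => weakDeriv V e (weakDeriv V e' φ) t * θ (x - t)) :=
    fun e e' => integrable_translate_mul (hφ.hasWeakDerivOn_weakDeriv hV e' e).1.2.1
      hθ.contDiff.continuous hθ.hasCompactSupport hθ.tsupport_subset hx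
  have habs : ∀ e e', IntegrableOn
      (fun t => |weakDeriv V e (weakDeriv V e' φ) t| * θ (x - t)) V := by
    intro e e'
    have := (hint e e').abs.integrableOn (s := V)
    refine this.congr_fun (fun t _ => ?_) hV.measurableSet
    simp only [abs_mul, abs_of_nonneg (hθ.nonneg (x - t))]
  obtain ⟨hi, he⟩ := setIntegral_leviQ_mul (V := V) (θ := fun t => θ (x - t)) W₁ W₂
    (hint dirY1 dirY1).integrableOn (hint dirY1 dirX2).integrableOn (hint dirY1 dirY2).integrableOn
    (hint dirX2 dirX2).integrableOn (hint dirY2 dirY2).integrableOn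
  rw [hsec, hsec, hsec, hsec, hsec, ← he]
  have hsum := ((habs dirY1 dirY1).fun_add (habs dirY1 dirX2)).fun_add (habs dirY1 dirY2)
  have hK : K ≤ |K| := le_abs_self K
  calc _ ≤ ∫ t in V, (4 * |K| + 4) * η *
        ((|weakDeriv V dirY1 (weakDeriv V dirY1 φ) t| * θ (x - t) +
          |weakDeriv V dirY1 (weakDeriv V dirX2 φ) t| * θ (x - t)) +
          |weakDeriv V dirY1 (weakDeriv V dirY2 φ) t| * θ (x - t)) := by
        refine integral_mono_ae hi (hsum.const_mul _) ?_
        refine ae_restrict_of_ae ?_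
        filter_upwards [hae] with t ht
        by_cases htx : t ∈ Metric.closedBall x ε
        · have := mul_le_mul_of_nonneg_right (leviQ_le_of_deltaOp_nonpos (ht htx) hη1
            (hgrad t htx).1 (hgrad t htx).2 (hW₁.trans hK) (hW₂.trans hK)) (hθ.nonneg (x - t))
          refine this.trans (le_of_eq ?_)
          ring
        · have : θ (x - t) = 0 := hθ.eq_zero (by
            simpa [dist_eq_norm, norm_sub_rev] using htx)
          simp [this]
    _ ≤ (4 * |K| + 4) * η * ((B₀ * ε ^ (-(3 * (1 / p.toReal))) +
          B₁ * ε ^ (-(3 * (1 / p.toReal)))) + B₂ * ε ^ (-(3 * (1 / p.toReal)))) := by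
        rw [integral_const_mul]
        refine mul_le_mul_of_nonneg_left ?_ (by positivity)
        rw [integral_add ((habs dirY1 dirY1).fun_add (habs dirY1 dirX2)) (habs dirY1 dirY2),
          integral_add (habs dirY1 dirY1) (habs dirY1 dirX2)]
        exact add_le_add (add_le_add (h₀ x ε θ hε hθ hx) (h₁ x ε θ hε hθ hx))
          (h₂ x ε θ hε hθ hx)
    _ = _ := by ring

theorem norm_pair_le {W₁ W₂ v : ℂ} {K : ℝ} (hW₁ : ‖W₁‖ ≤ K) (hW₂ : ‖W₂‖ ≤ K) (hv : ‖v‖ = 1) :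
    ‖(((W₁ * v).im, W₂ * v) : ℝ × ℂ)‖ ≤ K := by
  rw [Prod.norm_def]
  refine max_le ?_ ?_
  · refine (Complex.abs_im_le_norm _).trans ?_
    rwa [norm_mul, hv, mul_one]
  · change ‖W₂ * v‖ ≤ K
    rwa [norm_mul, hv, mul_one]

theorem not_disc_touches_graph {V : Set (ℝ × ℂ)} (hV : IsOpen V) {p : ℝ≥0∞} {α : ℝ≥0}
    (hp : 1 ≤ p) (hα : 3 / p < (α : ℝ≥0∞)) (hα_one : α < 1) {φ : ℝ × ℂ → ℝ}
    (hφ_holder : IsC1Holder α φ V) (hφ_sobolev : MemSobolev p V 2 φ) {q₁ q₂ : ℂ → ℂ}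
    (hq₁ : Differentiable ℂ q₁) (hq₂ : Differentiable ℂ q₂) {z₀ : ℂ}
    (hz₀ : ((q₁ z₀).im, q₂ z₀) ∈ V) {N : Set (ℝ × ℂ)} (hN : N ∈ 𝓝 ((q₁ z₀).im, q₂ z₀))
    (hLevi : ∀ᵐ t, t ∈ N → deltaOp V (tauOf φ) φ t ≤ 0)
    (h₀ : (q₁ z₀).re = φ ((q₁ z₀).im, q₂ z₀)) {c : ℝ} (hc : 0 < c)
    (htouch : ∀ᶠ ζ in 𝓝 z₀, (q₁ ζ).re - φ ((q₁ ζ).im, q₂ ζ) ≤ -c * ‖ζ - z₀‖ ^ 2) : False := by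
  set y : ℂ → ℝ × ℂ := fun ζ => ((q₁ ζ).im, q₂ ζ) with hy
  have hyc : Continuous y := (Complex.continuous_im.comp hq₁.continuous).prodMk hq₂.continuous
  -- the neighbourhood on which everything takes place
  obtain ⟨R, hR, hRV, hRN⟩ : ∃ R : ℝ, 0 < R ∧ Metric.closedBall (y z₀) (4 * R) ⊆ V ∧
      Metric.closedBall (y z₀) (4 * R) ⊆ N := by
    obtain ⟨r, hr, h⟩ := Metric.nhds_basis_closedBall.mem_iff.1
      (inter_mem (hV.mem_nhds hz₀) hN)
    refine ⟨r / 4, by positivity, ?_, ?_⟩ <;> rw [mul_div_cancel₀ _ (by norm_num : (4 : ℝ) ≠ 0)]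
    · exact fun x hx => (h hx).1
    · exact fun x hx => (h hx).2
  obtain ⟨f, hf1, hfc, hfφ, hfφ'⟩ := exists_contDiff_hasCompactSupport_eq hR
    (hφ_holder.1.mono (Metric.ball_subset_closedBall.trans hRV))
  obtain ⟨H, hH⟩ := hφ_holder.2 _ (isCompact_closedBall (y z₀) (4 * R)) hRV
  obtain ⟨ρ, hρ, hρt⟩ : ∃ ρ : ℝ, 0 < ρ ∧ ∀ ζ ∈ Metric.closedBall z₀ ρ,
      y ζ ∈ Metric.closedBall (y z₀) R ∧ (q₁ ζ).re - φ (y ζ) ≤ -c * ‖ζ - z₀‖ ^ 2 := by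
    obtain ⟨ρ, hρ, h⟩ := Metric.nhds_basis_closedBall.mem_iff.1
      ((hyc.continuousAt.eventually_mem (Metric.closedBall_mem_nhds (y z₀) hR)).and htouch)
    exact ⟨ρ, hρ, fun ζ hζ => h hζ⟩
  obtain ⟨K, hK⟩ : ∃ K : ℝ, ∀ ζ ∈ Metric.closedBall z₀ ρ, ‖deriv q₁ ζ‖ ≤ K ∧ ‖deriv q₂ ζ‖ ≤ K := by
    have hdq : ∀ {q : ℂ → ℂ}, Differentiable ℂ q → Continuous (deriv q) := fun hq =>
      (differentiableOn_univ.1 (hq.differentiableOn.deriv isOpen_univ)).continuous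
    obtain ⟨K₁, h₁⟩ := (isCompact_closedBall z₀ ρ).exists_bound_of_continuousOn
      (hdq hq₁).continuousOn
    obtain ⟨K₂, h₂⟩ := (isCompact_closedBall z₀ ρ).exists_bound_of_continuousOn
      (hdq hq₂).continuousOn
    exact ⟨max K₁ K₂, fun ζ hζ => ⟨(h₁ ζ hζ).trans (le_max_left _ _),
      (h₂ ζ hζ).trans (le_max_right _ _)⟩⟩
  have hK0 : 0 ≤ K := (norm_nonneg _).trans (hK z₀ (Metric.mem_closedBall_self hρ.le)).1
  obtain ⟨C, hC, hmoll⟩ := exists_isMollifier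
  obtain ⟨B, hB, hlevi⟩ := IsMollifier.exists_setIntegral_leviQ_le hV hp hφ_sobolev hC.le K
  -- exponents
  set a : ℝ := (α : ℝ) with ha
  set s : ℝ := 3 * (1 / p.toReal) with hs
  have hsa : s < a := by
    have h1 := (ENNReal.toReal_lt_toReal (ne_top_of_lt hα) ENNReal.coe_ne_top).2 hα
    rw [ENNReal.toReal_div] at h1
    simpa [hs, ha, div_eq_mul_inv] using h1
  have hs0 : 0 ≤ s := by positivity
  have ha1 : a < 1 := by exact_mod_cast hα_one
  have ha0 : 0 < a := hs0.trans_lt hsa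
  -- S ε^a will bound the displacement of the maximum. In G, the term c S comes from the gradient of
  -- the quadratic perturbation; of the two terms H K, one is the mollification error of the
  -- gradient and the other its oscillation over a ball of radius ε.
  set S : ℝ := √(4 * H / c) with hS
  set G : ℝ := c * S + 2 * H * K with hG
  have hG0 : 0 ≤ G := by positivity
  -- the choice of `ε`
  obtain ⟨ε, hε, hεR, hε1, hεS, hεG, hεc⟩ : ∃ ε : ℝ, 0 < ε ∧ ε < R ∧ ε < 1 ∧ S * ε ^ a < ρ ∧
      G * ε ^ a < 1 ∧ B * G * ε ^ (a - s) < 2 * c := by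
    have hta : ∀ b : ℝ, 0 < b → ∀ D : ℝ,
        Tendsto (fun ε : ℝ => D * ε ^ b) (𝓝[>] 0) (𝓝 0) := by
      intro b hb D
      have h1 : Tendsto (fun ε : ℝ => ε ^ b) (𝓝 0) (𝓝 0) := by
        have := (Real.continuousAt_rpow_const 0 b (Or.inr hb.le)).tendsto
        rwa [Real.zero_rpow hb.ne'] at this
      simpa using (h1.mono_left nhdsWithin_le_nhds).const_mul D
    have hev : ∀ᶠ ε : ℝ in 𝓝[>] 0, 0 < ε ∧ ε < R ∧ ε < 1 ∧ S * ε ^ a < ρ ∧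
        G * ε ^ a < 1 ∧ B * G * ε ^ (a - s) < 2 * c := by
      filter_upwards [self_mem_nhdsWithin, nhdsWithin_le_nhds (Iio_mem_nhds hR),
        nhdsWithin_le_nhds (Iio_mem_nhds one_pos), (hta a ha0 S).eventually_lt_const hρ,
        (hta a ha0 G).eventually_lt_const one_pos,
        (hta (a - s) (by linarith) (B * G)).eventually_lt_const (by positivity : 0 < 2 * c)]
        with ε h1 h2 h3 h4 h5 h6 using ⟨h1, h2, h3, h4, h5, h6⟩
    exact hev.exists
  obtain ⟨θ, hθ⟩ := hmoll ε hε
  set M : ℝ := H * ε ^ a with hM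
  have hM0 : 0 ≤ M := by positivity
  have hsub : ∀ x ∈ Metric.closedBall (y z₀) R,
      Metric.closedBall x ε ⊆ Metric.closedBall (y z₀) (2 * R) := fun x hx =>
    Metric.closedBall_subset_closedBall' (by rw [Metric.mem_closedBall] at hx; linarith)
  have hsub2 : Metric.closedBall (y z₀) (2 * R) ⊆ Metric.closedBall (y z₀) (4 * R) :=
    Metric.closedBall_subset_closedBall (by linarith)
  have hDf : ∀ x ∈ Metric.closedBall (y z₀) R, ∀ t ∈ Metric.closedBall x ε,
      ‖fderiv ℝ f t - fderiv ℝ f x‖ ≤ M := by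
    intro x hx t ht
    have ht2 := hsub x hx ht
    have hx2 := hsub x hx (Metric.mem_closedBall_self hε.le)
    rw [hfφ' t ht2, hfφ' x hx2, ← dist_eq_norm]
    exact hH.dist_le_of_le (hsub2 ht2) (hsub2 hx2) ht
  set F := mollify f θ with hF
  have hfl : LocallyIntegrable f := hf1.continuous.locallyIntegrable
  have hFs : ContDiff ℝ ∞ F := contDiff_mollify hfl hθ.contDiff hθ.hasCompactSupport
  have hFf : ∀ x ∈ Metric.closedBall (y z₀) R, |F x - φ x| ≤ M * ε := by
    intro x hx
    rw [← hfφ x (hsub x hx (Metric.mem_closedBall_self hε.le))]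
    exact hθ.abs_mollify_sub_le_of_fderiv hf1 hε.le (hDf x hx)
  -- the maximum of the perturbed function
  set k : ℂ → ℝ := fun ζ => (q₁ ζ).re - F ((q₁ ζ).im, q₂ ζ) + c / 2 * ‖ζ - z₀‖ ^ 2 with hk
  have hkc : Continuous k := by
    refine ((Complex.continuous_re.comp hq₁.continuous).sub (hFs.continuous.comp hyc)).add ?_
    fun_prop
  obtain ⟨z, hz, hzmax⟩ := (isCompact_closedBall z₀ ρ).exists_isMaxOn
    ⟨z₀, Metric.mem_closedBall_self hρ.le⟩ hkc.continuousOn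
  obtain ⟨hyz, hzt⟩ := hρt z hz
  have hdist : ‖z - z₀‖ ≤ S * ε ^ a := by
    have h1 : k z₀ ≤ k z := hzmax (Metric.mem_closedBall_self hρ.le)
    have h2 : -(M * ε) ≤ k z₀ := by
      have := hFf (y z₀) (Metric.mem_closedBall_self hR.le)
      rw [abs_le] at this
      simp only [hk, sub_self, norm_zero]
      change -(M * ε) ≤ (q₁ z₀).re - F (y z₀) + _
      rw [h₀]
      change -(M * ε) ≤ φ (y z₀) - F (y z₀) + _
      linarith
    have h3 : k z ≤ -(c / 2) * ‖z - z₀‖ ^ 2 + M * ε := by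
      have := hFf (y z) hyz
      rw [abs_le] at this
      change (q₁ z).re - F (y z) + _ ≤ _
      linarith
    have h4 : ‖z - z₀‖ ^ 2 ≤ 4 * H / c * (ε ^ a * ε) := by
      rw [div_mul_eq_mul_div, le_div_iff₀ hc]
      have : M * ε = H * (ε ^ a * ε) := by rw [hM]; ring
      rw [this] at h2 h3
      linarith
    -- This weakens the natural displacement ε^((1+a)/2) to ε^a, the same order as the gradient
    -- error.
    have h5 : ε ≤ ε ^ a := by
      have := Real.rpow_le_rpow_of_exponent_ge hε hε1.le ha1.le
      rwa [Real.rpow_one] at this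
    have h6 : ‖z - z₀‖ ^ 2 ≤ (S * ε ^ a) ^ 2 := by
      rw [mul_pow, hS, Real.sq_sqrt (by positivity)]
      refine h4.trans (mul_le_mul_of_nonneg_left ?_ (by positivity))
      rw [pow_two]
      exact mul_le_mul_of_nonneg_left h5 (by positivity)
    exact le_of_sq_le_sq h6 (by positivity)
  have hloc : IsLocalMax k z := by
    refine hzmax.isLocalMax ?_
    refine mem_of_superset (Metric.isOpen_ball.mem_nhds ?_) Metric.ball_subset_closedBall
    rw [mem_ball_iff_norm]
    linarith
  -- the tangent vector of the disc is almost tangent to the graph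
  have hgrad : ∀ v : ℂ, ‖v‖ = 1 → ∀ t ∈ Metric.closedBall (y z) ε,
      |(deriv q₁ z * v).re - fderiv ℝ φ t ((deriv q₁ z * v).im, deriv q₂ z * v)| ≤ G * ε ^ a := by
    intro v hv t ht
    set w : ℝ × ℂ := ((deriv q₁ z * v).im, deriv q₂ z * v) with hw
    have hwK : ‖w‖ ≤ K := norm_pair_le (hK z hz).1 (hK z hz).2 hv
    have e1 := abs_gradient_test_disc hFs hq₁ hq₂ (c := c / 2) (by positivity) hloc hv
    have e2 := hθ.abs_fderiv_mollify_sub_le hf1 hfc (hDf (y z) hyz) w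
    have e3 : |fderiv ℝ f t w - fderiv ℝ f (y z) w| ≤ M * ‖w‖ := by
      rw [← sub_apply, ← Real.norm_eq_abs]
      exact ((fderiv ℝ f t - fderiv ℝ f (y z)).le_opNorm w).trans
        (mul_le_mul_of_nonneg_right (hDf (y z) hyz t ht) (norm_nonneg _))
    rw [← hfφ' t (hsub (y z) hyz ht)]
    have e4 : M * ‖w‖ ≤ M * K := mul_le_mul_of_nonneg_left hwK hM0
    have e5 : c * ‖z - z₀‖ ≤ c * (S * ε ^ a) := mul_le_mul_of_nonneg_left hdist hc.le
    have e6 : G * ε ^ a = c * (S * ε ^ a) + 2 * (M * K) := by rw [hG, hM]; ring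
    change |(deriv q₁ z * v).re - fderiv ℝ F (y z) w| ≤ _ at e1
    rw [e6]
    rw [abs_le] at e1 e2 e3 ⊢
    constructor <;> linarith
  have hlap := laplacian_test_disc hFs hq₁ hq₂ (c := c / 2) hloc
  have hVx : Metric.closedBall (y z) ε ⊆ V := (hsub (y z) hyz).trans (hsub2.trans hRV)
  have hup := hlevi (y z) ε (G * ε ^ a) f θ (deriv q₁ z) (deriv q₂ z) hε hθ hVx hfl
    (fun t ht => hfφ t (hsub (y z) hyz ht)) hεG.le (by positivity) (hK z hz).1 (hK z hz).2
    (by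
      filter_upwards [hLevi] with t ht h using ht (hRN (hsub2 (hsub (y z) hyz h))))
    (fun t ht => ⟨by simpa using hgrad 1 (by simp) t ht, hgrad Complex.I (by simp) t ht⟩)
  -- The exponent a - s is positive, and ε was chosen to make this upper bound smaller than the
  -- lower bound 2c.
  have hpow : B * (G * ε ^ a) * ε ^ (-(3 * (1 / p.toReal))) = B * G * ε ^ (a - s) := by
    rw [sub_eq_add_neg, Real.rpow_add hε, hs]; ring
  rw [hpow] at hup
  have := hlap.trans hup
  linarith

/-! ### Approximation by real parts of entire functions on the unit circle -/

theorem exists_eq_entire_add_conj_of_mem_span_fourier {g : C(AddCircle (1 : ℝ), ℂ)}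
    (hg : g ∈ Submodule.span ℂ (range (fourier (T := 1)))) :
    ∃ F G : ℂ → ℂ, Differentiable ℂ F ∧ Differentiable ℂ G ∧
      ∀ x : AddCircle (1 : ℝ), g x = F (AddCircle.toCircle x) + conj (G (AddCircle.toCircle x)) := by
  induction hg using Submodule.span_induction with
  | mem g hg =>
    obtain ⟨n, rfl⟩ := hg
    obtain ⟨m, rfl | rfl⟩ := n.eq_nat_or_neg
    · refine ⟨fun z => z ^ m, fun _ => 0, by fun_prop, by fun_prop, fun x => ?_⟩
      rw [fourier_apply, AddCircle.toCircle_zsmul]; simp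
    · refine ⟨fun _ => 0, fun z => z ^ m, by fun_prop, by fun_prop, fun x => ?_⟩
      rw [fourier_neg, fourier_apply, AddCircle.toCircle_zsmul]; simp
  | zero => exact ⟨fun _ => 0, fun _ => 0, by fun_prop, by fun_prop, by simp⟩
  | add g₁ g₂ _ _ h₁ h₂ =>
    obtain ⟨F₁, G₁, hF₁, hG₁, e₁⟩ := h₁
    obtain ⟨F₂, G₂, hF₂, hG₂, e₂⟩ := h₂
    refine ⟨fun z => F₁ z + F₂ z, fun z => G₁ z + G₂ z, hF₁.add hF₂, hG₁.add hG₂, fun x => ?_⟩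
    rw [ContinuousMap.add_apply, e₁, e₂, map_add]; ring
  | smul c g _ h =>
    obtain ⟨F, G, hF, hG, e⟩ := h
    refine ⟨fun z => c * F z, fun z => conj c * G z, hF.const_mul c, hG.const_mul _, fun x => ?_⟩
    rw [ContinuousMap.smul_apply, e, map_mul, Complex.conj_conj, smul_eq_mul]; ring

theorem exists_entire_re_near_on_sphere {u : ℂ → ℝ} (hu : ContinuousOn u (Metric.sphere 0 1))
    {δ : ℝ} (hδ : 0 < δ) :
    ∃ F : ℂ → ℂ, Differentiable ℂ F ∧ ∀ ζ ∈ Metric.sphere (0 : ℂ) 1, |u ζ - (F ζ).re| < δ := by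
  let g : C(AddCircle (1 : ℝ), ℂ) := ⟨fun x => (u (AddCircle.toCircle x) : ℂ), by
    refine Complex.continuous_ofReal.comp (hu.comp_continuous ?_ ?_)
    · exact continuous_subtype_val.comp AddCircle.continuous_toCircle
    · intro x; exact mem_sphere_zero_iff_norm.2 (Circle.norm_coe _)⟩
  have hg : g ∈ closure (Submodule.span ℂ (range (fourier (T := 1))) : Set C(AddCircle (1 : ℝ), ℂ)) := by
    have := span_fourier_closure_eq_top (T := (1 : ℝ))
    rw [← Submodule.topologicalClosure_coe, this]
    trivial
  obtain ⟨k, hk, hdist⟩ := Metric.mem_closure_iff.1 hg δ hδ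
  obtain ⟨F, G, hF, hG, e⟩ := exists_eq_entire_add_conj_of_mem_span_fourier hk
  -- Conjugation does not change real parts, so the antiholomorphic part may be replaced by its
  -- conjugate.
  refine ⟨fun z => F z + G z, hF.add hG, fun ζ hζ => ?_⟩
  obtain ⟨x, hx⟩ := (AddCircle.homeomorphCircle (T := (1 : ℝ)) one_ne_zero).surjective
    ⟨ζ, by simpa [Submonoid.unitSphere] using hζ⟩
  have hx' : (AddCircle.toCircle x : ℂ) = ζ := by
    have := congrArg (fun z : Circle => (z : ℂ)) hx
    simpa [AddCircle.homeomorphCircle_apply] using this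
  have h1 := (ContinuousMap.dist_lt_iff hδ).1 hdist x
  rw [Complex.dist_eq, e x, hx'] at h1
  have h2 := (Complex.abs_re_le_norm _).trans_lt h1
  simpa [g, hx'] using h2

theorem circleAverage_re_of_entire {F : ℂ → ℂ} (hF : Differentiable ℂ F) :
    Real.circleAverage (fun ζ => (F ζ).re) 0 1 = (F 0).re := by
  have h1 : Real.circleAverage F 0 1 = F 0 := hF.diffContOnCl.circleAverage
  have h2 := Complex.reCLM.circleAverage_comp_comm
    (hF.continuous.continuousOn.circleIntegrable' (c := 0) (R := 1))
  rw [h1] at h2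
  exact h2

theorem exists_entire_re_gt_on_sphere {u : ℂ → ℝ} (hu : ContinuousOn u (Metric.sphere 0 1))
    {A : ℝ} (hA : Real.circleAverage u 0 1 < A) :
    ∃ F : ℂ → ℂ, Differentiable ℂ F ∧ (∀ ζ ∈ Metric.sphere (0 : ℂ) 1, u ζ < (F ζ).re) ∧
      (F 0).re < A := by
  -- One δ is the approximation error, a second lifts Re F above u, and the third keeps the value at
  -- the centre strictly below A.
  set δ := (A - Real.circleAverage u 0 1) / 3 with hδ
  have hδ0 : 0 < δ := by rw [hδ]; linarith
  obtain ⟨F, hF, hnear⟩ := exists_entire_re_near_on_sphere hu hδ0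
  refine ⟨fun z => F z + δ, hF.add_const _, fun ζ hζ => ?_, ?_⟩
  · have := (abs_lt.1 (hnear ζ hζ)).2
    simp only [Complex.add_re, Complex.ofReal_re]
    linarith
  · have hi : CircleIntegrable u 0 1 := hu.circleIntegrable zero_le_one
    have h1 : Real.circleAverage (fun ζ => (F ζ - δ).re) 0 1 ≤ Real.circleAverage u 0 1 := by
      refine Real.circleAverage_mono ?_ hi fun ζ hζ => ?_
      · exact (Complex.continuous_re.comp
          (hF.sub_const _).continuous).continuousOn.circleIntegrable zero_le_one
      · rw [abs_one] at hζ
        have := (abs_lt.1 (hnear ζ hζ)).1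
        simp only [Complex.sub_re, Complex.ofReal_re]
        linarith
    rw [circleAverage_re_of_entire (F := fun ζ => F ζ - δ) (hF.sub_const _)] at h1
    simp only [Complex.sub_re, Complex.add_re, Complex.ofReal_re] at h1 ⊢
    linarith

/-! ### A continuity principle -/

theorem continuousOn_neg_log_infDist_compl {D : Set C2} (hD : IsOpen D) (hne : Dᶜ.Nonempty) :
    ContinuousOn (fun z => -Real.log (Metric.infDist z Dᶜ)) D := by
  refine ContinuousOn.neg (ContinuousOn.log (Metric.continuous_infDist_pt _).continuousOn ?_)
  intro z hz
  exact ((hD.isClosed_compl.notMem_iff_infDist_pos hne).1 (not_not.2 hz)).ne'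

/-- Each point of the disc is moved by a vector depending holomorphically on ζ, of length at most
δ(ζ). Equality holds at z₀, where the vector ends at a nearest complement point; elsewhere the
quadratic perturbation leaves a definite gap. -/
theorem exists_touching_disc {D : Set C2} (hD : IsOpen D) (hne : Dᶜ.Nonempty) {a w : C2}
    (hdisc : ∀ ζ : ℂ, ‖ζ‖ ≤ 1 → a + ζ • w ∈ D)
    (hlt : Real.circleAverage (fun ζ : ℂ => -Real.log (Metric.infDist (a + ζ • w) Dᶜ)) 0 1 <
      -Real.log (Metric.infDist a Dᶜ)) :
    ∃ (q : ℂ → C2) (z₀ : ℂ) (c : ℝ), Differentiable ℂ q ∧ 0 < c ∧ q z₀ ∉ D ∧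
      ∀ᶠ ζ in 𝓝 z₀, c * ‖ζ - z₀‖ ^ 2 ≤ Metric.infDist (q ζ) Dᶜ := by
  set δ : ℂ → ℝ := fun ζ => Metric.infDist (a + ζ • w) Dᶜ with hδ
  set u : ℂ → ℝ := fun ζ => -Real.log (δ ζ) with hu
  have huc : ContinuousOn u (Metric.closedBall 0 1) := by
    refine (continuousOn_neg_log_infDist_compl hD hne).comp
      (f := fun ζ : ℂ => a + ζ • w) (by fun_prop) ?_
    intro ζ hζ
    exact hdisc ζ (by simpa using hζ)
  have hδpos : ∀ ζ ∈ Metric.closedBall (0 : ℂ) 1, 0 < δ ζ := fun ζ hζ =>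
    (hD.isClosed_compl.notMem_iff_infDist_pos hne).1
      (not_not.2 (hdisc ζ (by simpa using hζ)))
  obtain ⟨F, hF, hFu, hF0⟩ := exists_entire_re_gt_on_sphere
    (huc.mono Metric.sphere_subset_closedBall) hlt
  have hu0 : u 0 = -Real.log (Metric.infDist a Dᶜ) := by simp [hu, hδ]
  rw [← hu0] at hF0
  have hFc : Continuous fun ζ => (F ζ).re := Complex.continuous_re.comp hF.continuous
  -- With this choice g(0) = 2κ, while g < κ on the unit circle, so the maximum is interior.
  set κ : ℝ := (u 0 - (F 0).re) / 2 with hκ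
  have hκ0 : 0 < κ := by rw [hκ]; linarith
  set g : ℂ → ℝ := fun ζ => u ζ - (F ζ).re + κ * ‖ζ‖ ^ 2 with hg
  have hgc : ContinuousOn g (Metric.closedBall 0 1) :=
    (huc.sub hFc.continuousOn).add (by fun_prop)
  obtain ⟨z₀, hz₀, hmax⟩ := (isCompact_closedBall (0 : ℂ) 1).exists_isMaxOn
    ⟨0, Metric.mem_closedBall_self zero_le_one⟩ hgc
  have hz₀' : z₀ ∈ Metric.ball (0 : ℂ) 1 := by
    by_contra hnot
    have hs : z₀ ∈ Metric.sphere (0 : ℂ) 1 := by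
      simp at hnot hz₀ ⊢; linarith
    have h1 := hFu z₀ hs
    have h2 : g 0 ≤ g z₀ := hmax (Metric.mem_closedBall_self zero_le_one)
    have h3 : ‖z₀‖ = 1 := by simpa using hs
    simp only [hg, h3, norm_zero] at h2
    linarith
  -- absorb the terms of degree at most one of `κ ‖ζ‖ ^ 2` into the entire function
  set E : ℂ → ℂ := fun ζ => F ζ - 2 * κ * conj z₀ * ζ + (κ * ‖z₀‖ ^ 2 + g z₀ : ℝ) with hE
  have hEd : Differentiable ℂ E := by
    refine (hF.sub ?_).add_const _
    fun_prop
  have hEre : ∀ ζ, (E ζ).re = (F ζ).re - κ * ‖ζ‖ ^ 2 + κ * ‖ζ - z₀‖ ^ 2 + g z₀ := by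
    intro ζ
    rw [← Complex.normSq_eq_norm_sq, ← Complex.normSq_eq_norm_sq, Complex.normSq_apply,
      Complex.normSq_apply]
    simp only [hE]
    rw [← Complex.normSq_eq_norm_sq, Complex.normSq_apply]
    simp
    ring
  have hδle : ∀ ζ ∈ Metric.closedBall (0 : ℂ) 1,
      Real.exp (-(E ζ).re) * Real.exp (κ * ‖ζ - z₀‖ ^ 2) ≤ δ ζ := by
    intro ζ hζ
    rw [← Real.exp_add, ← Real.le_log_iff_exp_le (hδpos ζ hζ), hEre]
    have : g ζ ≤ g z₀ := hmax hζ
    simp only [hg, hu] at this ⊢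
    linarith
  have hδeq : δ z₀ = Real.exp (-(E z₀).re) := by
    rw [← Real.exp_log (hδpos z₀ hz₀), hEre]
    congr 1
    simp only [hg, hu, sub_self, norm_zero]
    ring
  obtain ⟨b, hb, hdb⟩ := hD.isClosed_compl.exists_infDist_eq_dist hne (a + z₀ • w)
  -- The exponential factor is 1 at z₀ and rescales the displacement to length exp(-Re E(ζ)).
  set q : ℂ → C2 := fun ζ => a + ζ • w + Complex.exp (E z₀ - E ζ) • (b - (a + z₀ • w)) with hq
  have hqd : Differentiable ℂ q := by
    refine Differentiable.add (by fun_prop) (Differentiable.smul_const ?_ _)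
    exact (hEd.const_sub _).cexp
  have hqdist : ∀ ζ, dist (a + ζ • w) (q ζ) = Real.exp (-(E ζ).re) := by
    intro ζ
    have h1 : ‖b - (a + z₀ • w)‖ = Real.exp (-(E z₀).re) := by
      rw [← hδeq, ← dist_eq_norm, dist_comm]
      exact hdb.symm
    rw [dist_eq_norm, hq]
    simp only [sub_add_cancel_left, norm_neg, norm_smul, Complex.norm_exp, h1, ← Real.exp_add]
    congr 1
    simp only [Complex.sub_re]
    ring
  obtain ⟨m, hm0, hm⟩ : ∃ m : ℝ, 0 < m ∧
      ∀ ζ ∈ Metric.closedBall (0 : ℂ) 1, m ≤ Real.exp (-(E ζ).re) := by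
    have hc : Continuous fun ζ => Real.exp (-(E ζ).re) :=
      Real.continuous_exp.comp (Complex.continuous_re.comp hEd.continuous).neg
    obtain ⟨z, -, hz⟩ := (isCompact_closedBall (0 : ℂ) 1).exists_isMinOn
      ⟨0, Metric.mem_closedBall_self zero_le_one⟩ hc.continuousOn
    exact ⟨_, Real.exp_pos _, fun ζ hζ => hz hζ⟩
  refine ⟨q, z₀, m * κ, hqd, by positivity, ?_, ?_⟩
  · have : q z₀ = b := by simp [hq]
    rw [this]; exact hb
  · filter_upwards [Metric.isOpen_ball.mem_nhds hz₀'] with ζ hζ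
    have hζ' := Metric.ball_subset_closedBall hζ
    have h1 : δ ζ ≤ Metric.infDist (q ζ) Dᶜ + dist (a + ζ • w) (q ζ) :=
      Metric.infDist_le_infDist_add_dist
    rw [hqdist] at h1
    have h2 := hδle ζ hζ'
    have h3 := Real.add_one_le_exp (κ * ‖ζ - z₀‖ ^ 2)
    have h4 := hm ζ hζ'
    have h5 : 0 ≤ κ * ‖ζ - z₀‖ ^ 2 := by positivity
    have h6 : m * (κ * ‖ζ - z₀‖ ^ 2) ≤ Real.exp (-(E ζ).re) * (κ * ‖ζ - z₀‖ ^ 2) :=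
      mul_le_mul_of_nonneg_right h4 h5
    have h7 := mul_le_mul_of_nonneg_left h3 (Real.exp_pos (-(E ζ).re)).le
    linarith

/-- An open set that no analytic disc touches to second order from inside is pseudoconvex. -/
theorem isPseudoconvex_of_forall_disc {D : Set C2} (hD : IsOpen D) (hne : Dᶜ.Nonempty)
    (h : ∀ (q : ℂ → C2) (z₀ : ℂ) (c : ℝ), Differentiable ℂ q → 0 < c → q z₀ ∉ D →
      ¬ ∀ᶠ ζ in 𝓝 z₀, c * ‖ζ - z₀‖ ^ 2 ≤ Metric.infDist (q ζ) Dᶜ) : IsPseudoconvex D := by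
  have hc := continuousOn_neg_log_infDist_compl hD hne
  refine ⟨hD, hc.upperSemicontinuousOn, fun a w hdisc => ⟨?_, ?_⟩⟩
  · refine ContinuousOn.circleIntegrable zero_le_one ?_
    refine hc.comp (f := fun ζ : ℂ => a + ζ • w) (by fun_prop) fun ζ hζ => hdisc ζ ?_
    exact le_of_eq (by simpa using hζ)
  · by_contra! hlt
    obtain ⟨q, z₀, c, hq, hc, hqz, hev⟩ := exists_touching_disc hD hne hdisc hlt
    exact h q z₀ c hq hc hqz hev

/-! ### The exceptional set is negligible -/

/-- The projection to (y₁, z₂) is 1-Lipschitz, and three-dimensional Hausdorff measure on ℝ × ℂ is a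
Haar measure, so it has the Lebesgue null sets. -/
theorem volume_graphParams_eq_zero {F U : Set C2} {V : Set (ℝ × ℂ)} {φ : ℝ × ℂ → ℝ}
    (hF : Measure.hausdorffMeasure (3 : ℝ) F = 0) : volume (graphParams φ V F U) = 0 := by
  have hlip : LipschitzWith 1 (fun z : C2 => (((z 0).im, z 1) : ℝ × ℂ)) := by
    refine LipschitzWith.of_dist_le_mul fun z z' => ?_
    have h : ∀ i, ‖(z - z') i‖ ≤ ‖z - z'‖ := fun i => PiLp.norm_apply_le _ i
    rw [NNReal.coe_one, one_mul, Prod.dist_eq, dist_eq_norm z z']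
    refine max_le ?_ ?_
    · refine le_trans ?_ (h 0)
      rw [Real.dist_eq, ← Complex.sub_im]
      exact Complex.abs_im_le_norm _
    · rw [dist_eq_norm]; exact h 1
  have hsub : graphParams φ V F U ⊆ (fun z : C2 => (((z 0).im, z 1) : ℝ × ℂ)) '' F := by
    rintro ξ ⟨-, hξ, -⟩
    exact ⟨graphPoint φ ξ, hξ, by simp [graphPoint]⟩
  have h0 : Measure.hausdorffMeasure (3 : ℝ) (graphParams φ V F U) = 0 := by
    refine measure_mono_null hsub (le_antisymm ?_ zero_le)
    refine (hlip.hausdorffMeasure_image_le (by norm_num) F).trans ?_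
    rw [hF, mul_zero]
  have h3 : ((Module.finrank ℝ (ℝ × ℂ) : ℕ) : ℝ) = 3 := by simp
  have hhaar : (Measure.hausdorffMeasure (3 : ℝ) : Measure (ℝ × ℂ)).IsAddHaarMeasure := by
    rw [← h3]; infer_instance
  exact Measure.absolutelyContinuous_isAddHaarMeasure volume
    (Measure.hausdorffMeasure (3 : ℝ) : Measure (ℝ × ℂ)) h0

/-! ### The hypograph of `φ` in the ball -/

/-- Raising x₁ by any amount less than l stays in D, hence below the graph. -/
theorem graph_gap_of_infDist {D : Set C2} {φ : ℝ × ℂ → ℝ}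
    (hgraph : ∀ z ∈ D, (z 0).re < φ ((z 0).im, z 1)) {z : C2} {l : ℝ}
    (hl0 : 0 < l) (hl : l ≤ Metric.infDist z Dᶜ) : (z 0).re + l ≤ φ ((z 0).im, z 1) := by
  refine le_of_forall_lt_imp_le_of_dense fun s hs => ?_
  rcases le_or_gt s (z 0).re with h | h
  · have hz : z ∈ D := not_not.1
      (Metric.notMem_of_dist_lt_infDist (x := z) (by rw [dist_self]; linarith))
    exact h.trans (hgraph z hz).le
  · set z' : C2 := z + EuclideanSpace.single 0 ((s - (z 0).re : ℝ) : ℂ) with hz'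
    have hd : dist z z' = s - (z 0).re := by
      rw [hz', dist_self_add_right, PiLp.norm_single, Complex.norm_real,
        Real.norm_of_nonneg (by linarith)]
    have hmem : z' ∈ D := not_not.1
      (Metric.notMem_of_dist_lt_infDist (x := z) (by rw [hd]; linarith))
    have h1 := hgraph z' hmem
    have e0 : z' 0 = z 0 + ((s - (z 0).re : ℝ) : ℂ) := by simp [hz']
    have e1 : z' 1 = z 1 := by simp [hz']
    rw [e0, e1, Complex.add_im, Complex.ofReal_im, add_zero, Complex.add_re,
      Complex.ofReal_re] at h1
    linarith

theorem continuousOn_graphPoint {φ : ℝ × ℂ → ℝ} {V : Set (ℝ × ℂ)} (hφ : ContinuousOn φ V) :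
    ContinuousOn (graphPoint φ) V := by
  refine (PiLp.continuous_toLp 2 _).comp_continuousOn (continuousOn_pi.2 fun i => ?_)
  fin_cases i
  · change ContinuousOn (fun ξ : ℝ × ℂ => (φ ξ : ℂ) + Complex.I * (ξ.1 : ℂ)) V
    refine (Complex.continuous_ofReal.comp_continuousOn hφ).add ?_
    fun_prop
  · exact continuous_snd.continuousOn

/-- If |q(z₀)| = r, then |q| has a local maximum at z₀ and is locally constant by the maximum
principle, although nearby points of the disc have norm less than r. -/
theorem norm_lt_of_touching_disc {D : Set C2} {r : ℝ} (hD : D ⊆ Metric.ball 0 r) {q : ℂ → C2}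
    (hq : Differentiable ℂ q) {z₀ : ℂ} (hqD : ∀ᶠ ζ in 𝓝[≠] z₀, q ζ ∈ D) : ‖q z₀‖ < r := by
  have hlt : ∀ᶠ ζ in 𝓝[≠] z₀, ‖q ζ‖ < r := by
    filter_upwards [hqD] with ζ hζ
    simpa using hD hζ
  have hle : ‖q z₀‖ ≤ r :=
    le_of_tendsto (hq.continuous.norm.continuousAt.tendsto.mono_left nhdsWithin_le_nhds)
      (hlt.mono fun _ h => h.le)
  refine lt_of_le_of_ne hle fun heq => ?_
  have hmax : IsLocalMax (norm ∘ q) z₀ := by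
    have := eventually_nhdsWithin_iff.1 hlt
    filter_upwards [this] with ζ hζ
    by_cases h : ζ = z₀
    · rw [h]
    · exact ((hζ h).le).trans heq.ge
  have hconst := Complex.norm_eventually_eq_of_isLocalMax
    (Eventually.of_forall fun ζ => hq ζ) hmax
  obtain ⟨ζ, h1, h2⟩ := (hlt.and (hconst.filter_mono nhdsWithin_le_nhds)).exists
  rw [h2, heq] at h1
  exact lt_irrefl _ h1

theorem proposition3p1
    -- the bounded domain `Ω ⊂ ℂ²` and the exceptional set `F ⊂ ∂Ω`
    (Ω F : Set C2)
    (hΩ_open : IsOpen Ω) (hΩ_conn : IsConnected Ω) (hΩ_bdd : Bornology.IsBounded Ω)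
    (hF_closed : IsClosed F) (hF_sub : F ⊆ frontier Ω)
    (hF_null : Measure.hausdorffMeasure (3 : ℝ) F = 0)
    (hC2 : ∀ ζ ∈ frontier Ω \ F, HasC2BoundaryAt Ω ζ)
    (hpsc : ∀ ζ ∈ frontier Ω \ F, IsLocallyPseudoconvexAt Ω ζ)
    -- the ball `U = B(0, r)`, the open set `U' ⊂ ℝ × ℂ`, the exponents and the function `φ`
    (r : ℝ) (hr : 0 < r) (U' : Set (ℝ × ℂ)) (hU'_open : IsOpen U')
    (hU' : ∀ z ∈ Metric.ball (0 : C2) r, ((z 0).im, z 1) ∈ U')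
    (p : ℝ≥0∞) (α : ℝ≥0) (hp : 3 < p) (hα : 3 / p < (α : ℝ≥0∞)) (hα_one : α < 1)
    (φ : ℝ × ℂ → ℝ) (hφ_holder : IsC1Holder α φ U') (hφ_sobolev : MemSobolev p U' 2 φ)
    (hφ_zero : φ 0 = 0) (hφ_grad : fderiv ℝ φ 0 = 0)
    (hΩU : Ω ∩ Metric.ball (0 : C2) r =
      {z ∈ Metric.ball (0 : C2) r | (z 0).re - φ ((z 0).im, z 1) < 0})
    -- the Levi condition off `F'`, for the part of the graph that lies in `U`
    (hLevi : ∀ᵐ ξ : ℝ × ℂ, ξ ∈ U' → graphPoint φ ξ ∈ Metric.ball (0 : C2) r →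
      ξ ∉ graphParams φ U' F (Metric.ball (0 : C2) r) → deltaOp U' (tauOf φ) φ ξ ≤ 0) :
    IsPseudoconvex (Ω ∩ Metric.ball (0 : C2) r) := by
  set U := Metric.ball (0 : C2) r with hU
  set D := Ω ∩ U with hD
  have hDo : IsOpen D := hΩ_open.inter Metric.isOpen_ball
  have hne : Dᶜ.Nonempty := by
    refine ⟨EuclideanSpace.single 0 (r : ℂ), fun h => ?_⟩
    have := h.2
    rw [hU, mem_ball_zero_iff, PiLp.norm_single, Complex.norm_real,
      Real.norm_of_nonneg hr.le] at this
    exact lt_irrefl _ this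
  have hgraph : ∀ z ∈ D, (z 0).re < φ ((z 0).im, z 1) := by
    intro z hz
    rw [hΩU] at hz
    linarith [hz.2]
  refine isPseudoconvex_of_forall_disc hDo hne fun q z₀ c hq hc hqz hev => ?_
  have hev' : ∀ᶠ ζ in 𝓝[≠] z₀, 0 < c * ‖ζ - z₀‖ ^ 2 ∧
      c * ‖ζ - z₀‖ ^ 2 ≤ Metric.infDist (q ζ) Dᶜ := by
    filter_upwards [nhdsWithin_le_nhds hev, self_mem_nhdsWithin] with ζ h1 h2
    have : 0 < ‖ζ - z₀‖ := norm_pos_iff.2 (sub_ne_zero.2 h2)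
    exact ⟨by positivity, h1⟩
  have hqD : ∀ᶠ ζ in 𝓝[≠] z₀, q ζ ∈ D := by
    filter_upwards [hev'] with ζ h
    exact not_not.1 (Metric.notMem_of_dist_lt_infDist (x := q ζ)
      (by rw [dist_self]; linarith [h.1, h.2]))
  have hbU : q z₀ ∈ U := by
    rw [hU, mem_ball_zero_iff]
    exact norm_lt_of_touching_disc inter_subset_right hq hqD
  set ξ₀ : ℝ × ℂ := ((q z₀ 0).im, q z₀ 1) with hξ₀
  have hξV : ξ₀ ∈ U' := hU' _ hbU
  have hφc : ContinuousOn φ U' := hφ_holder.1.continuousOn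
  have hcoord : ∀ i, Differentiable ℂ fun ζ => q ζ i := fun i =>
    (EuclideanSpace.proj (𝕜 := ℂ) i).differentiable.comp hq
  have hyc : Continuous fun ζ => (((q ζ 0).im, q ζ 1) : ℝ × ℂ) :=
    (Complex.continuous_im.comp (hcoord 0).continuous).prodMk (hcoord 1).continuous
  -- The point q(z₀) lies in U but not in D, so it is not below the graph; as a limit of points of D
  -- it is not above it either.
  have hge : φ ξ₀ ≤ (q z₀ 0).re := by
    by_contra! hlt
    apply hqz
    rw [hΩU]
    exact ⟨hbU, by linarith⟩
  have hle : (q z₀ 0).re ≤ φ ξ₀ := by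
    have h1 : Tendsto (fun ζ => (q ζ 0).re) (𝓝[≠] z₀) (𝓝 (q z₀ 0).re) :=
      ((Complex.continuous_re.comp (hcoord 0).continuous).tendsto z₀).mono_left
        nhdsWithin_le_nhds
    have h2 : Tendsto (fun ζ => φ ((q ζ 0).im, q ζ 1)) (𝓝[≠] z₀) (𝓝 (φ ξ₀)) :=
      ((hφc.continuousAt (hU'_open.mem_nhds hξV)).tendsto.comp (hyc.tendsto z₀)).mono_left
        nhdsWithin_le_nhds
    exact le_of_tendsto_of_tendsto h1 h2 (hqD.mono fun ζ h => (hgraph _ h).le)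
  have h₀ : (q z₀ 0).re = φ ξ₀ := le_antisymm hle hge
  have hgp : graphPoint φ ξ₀ = q z₀ := by
    ext i
    fin_cases i
    · refine Complex.ext ?_ ?_ <;> simp [graphPoint, h₀, hξ₀]
    · simp [graphPoint, hξ₀]
  -- The Levi condition is assumed only where the graph lies in U; by continuity this covers a
  -- neighbourhood of ξ₀.
  have hN : U' ∩ graphPoint φ ⁻¹' U ∈ 𝓝 ξ₀ := by
    refine inter_mem (hU'_open.mem_nhds hξV) ?_
    refine ((continuousOn_graphPoint hφc).continuousAt
      (hU'_open.mem_nhds hξV)).preimage_mem_nhds ?_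
    rw [hgp]
    exact Metric.isOpen_ball.mem_nhds hbU
  have hLevi' : ∀ᵐ t, t ∈ U' ∩ graphPoint φ ⁻¹' U → deltaOp U' (tauOf φ) φ t ≤ 0 := by
    have hnull : ∀ᵐ t : ℝ × ℂ, t ∉ graphParams φ U' F U :=
      measure_eq_zero_iff_ae_notMem.1 (volume_graphParams_eq_zero hF_null)
    filter_upwards [hLevi, hnull] with t h1 h2 h3 using h1 h3.1 h3.2 h2
  have hp1 : 1 ≤ p := le_trans (by norm_num) hp.le
  refine not_disc_touches_graph hU'_open hp1 hα hα_one hφ_holder hφ_sobolev (hcoord 0) (hcoord 1)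
    hξV hN hLevi' h₀ hc ?_
  filter_upwards [eventually_nhdsWithin_iff.1 hev'] with ζ hζ
  by_cases h : ζ = z₀
  · rw [h, sub_self, norm_zero]
    change (q z₀ 0).re - φ ξ₀ ≤ _
    rw [h₀]; simp
  · have := graph_gap_of_infDist hgraph (hζ h).1 (hζ h).2
    linarith
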